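/- An operator space is a closed linear subspace $E\subset B(H)$, $H$ a complex Hilbert space; $M_k(E)\subset M_k(B(H))=B(\ell_2^k(H))$ carries the induced norm. For a linear map $u\colon E\to F$ between operator spaces put $\|u\|_k=\|I_{M_k}\otimes u\colon M_k(E)\to M_k(F)\|$ and $\|u\|_{cb}=\sup_{k\ge 1}\|u\|_k$. The dual $E^*$ carries its operator space structure given by $M_k(E^*)=CB(E,M_k)$ isometrically, for all $k\ge 1$. Put $$d_k(E,F)=\inf\|u\|_k\|u^{-1}\|_k,\qquad d_{cb}(E,F)=\inf\|u\|_{cb}\|u^{-1}\|_{cb},$$ the infima running over all linear isomorphisms $u\colon E\to F$ (with value $\infty$ if there is none), and $$d_{SK}(E)=\inf\{d_{cb}(E,F)\mid F\subset K(\ell_2)\},$$ where $F$ runs over the closed subspaces of the space $K(\ell_2)$ of compact operators on $\ell_2$. Let $n\ge 1$ and let $OS_n$ be the set of all $n$-dimensional operator spaces, two spaces being identified when they are completely isometric. Let the weak topology on $OS_n$ be the topology defined by the family of pseudometrics $\log d_k$, $k\ge 1$ (so $E_i\to E$ weakly iff $\log d_k(E_i,E)\to 0$ for each $k\ge 1$).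 Corollary 17. Let $i\colon OS_n\to OS_n$ be the identity, considered as a map from $OS_n$ with the weak topology to $OS_n$ with the topology of the metric $\log d_{cb}$. Then $E\in OS_n$ is a point of continuity of $i$ if and only if $d_{SK}(E)=d_{SK}(E^*)=1$. -/

import Mathlib

open scoped ENNReal Topology

universe u v w

noncomputable section

namespace OpSpace

/-! ### Matrix norms and completely bounded maps -/

/-- A (possibly infinite) size `μ k x` for every `k × k` matrix `x` with entries in `V`.
Only two families of examples are used below: the norms of `M_k(E)` for a concrete operator
space `E`, and the norms of `M_k(E*)` for its operator space dual. -/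
abbrev MatNorm (V : Type u) : Type u := ∀ k : ℕ, Matrix (Fin k) (Fin k) V → ℝ≥0∞

section cb

variable {V : Type u} {W : Type v} [AddCommGroup V] [Module ℂ V] [AddCommGroup W] [Module ℂ W]

/-- `‖u‖_k`, the norm of `I_{M_k} ⊗ u : M_k(V) → M_k(W)`. -/
def levelNorm (μ : MatNorm V) (ν : MatNorm W) (k : ℕ) (u : V →ₗ[ℂ] W) : ℝ≥0∞ :=
  ⨆ (x : Matrix (Fin k) (Fin k) V) (_ : μ k x ≤ 1), ν k (x.map u)

/-- `‖u‖_cb = sup_{k ≥ 1} ‖u‖_k`. -/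
def cbNorm (μ : MatNorm V) (ν : MatNorm W) (u : V →ₗ[ℂ] W) : ℝ≥0∞ :=
  ⨆ (k : ℕ) (_ : 1 ≤ k), levelNorm μ ν k u

/-- `d_k(V, W) = inf ‖u‖_k ‖u⁻¹‖_k` over all linear isomorphisms `u : V → W`
(`∞` if there is none). -/
def dLevel (μ : MatNorm V) (ν : MatNorm W) (k : ℕ) : ℝ≥0∞ :=
  ⨅ u : V ≃ₗ[ℂ] W, levelNorm μ ν k u.toLinearMap * levelNorm ν μ k u.symm.toLinearMap

/-- `d_cb(V, W) = inf ‖u‖_cb ‖u⁻¹‖_cb` over all linear isomorphisms `u : V → W`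
(`∞` if there is none). -/
def dCb (μ : MatNorm V) (ν : MatNorm W) : ℝ≥0∞ :=
  ⨅ u : V ≃ₗ[ℂ] W, cbNorm μ ν u.toLinearMap * cbNorm ν μ u.symm.toLinearMap

/-- The existence of a completely isometric linear isomorphism `V → W`. -/
def CompletelyIsometric (μ : MatNorm V) (ν : MatNorm W) : Prop :=
  ∃ u : V ≃ₗ[ℂ] W, ∀ (k : ℕ) (x : Matrix (Fin k) (Fin k) V), ν k (x.map u) = μ k x

end cb

/-! ### Concrete operator spaces -/

section concrete

variable {H : Type u} [NormedAddCommGroup H] [InnerProductSpace ℂ H]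

variable (H) in
/-- The Hilbert space `ℓ₂ᵏ(H)`, the `ℓ₂`-direct sum of `k` copies of `H`. -/
def HilbertPow (k : ℕ) : Type u := PiLp 2 (fun _ : Fin k => H)

instance (k : ℕ) : NormedAddCommGroup (HilbertPow H k) :=
  inferInstanceAs (NormedAddCommGroup (PiLp 2 (fun _ : Fin k => H)))

instance (k : ℕ) : InnerProductSpace ℂ (HilbertPow H k) :=
  inferInstanceAs (InnerProductSpace ℂ (PiLp 2 (fun _ : Fin k => H)))

variable (H) in
/-- `ℓ₂ᵏ(H)` consists of the `k`-tuples of vectors of `H`. -/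
def HilbertPow.equiv (k : ℕ) : HilbertPow H k ≃L[ℂ] (Fin k → H) :=
  PiLp.continuousLinearEquiv 2 ℂ (fun _ : Fin k => H)

/-- The operator on `ℓ₂ᵏ(H)` given by a `k × k` matrix of operators on `H`:
`(T ξ)_i = ∑_j x_{ij} ξ_j`. -/
def amplify {k : ℕ} (x : Matrix (Fin k) (Fin k) (H →L[ℂ] H)) :
    HilbertPow H k →L[ℂ] HilbertPow H k :=
  ((HilbertPow.equiv H k).symm : (Fin k → H) →L[ℂ] HilbertPow H k) ∘L
    ContinuousLinearMap.pi (fun i => ∑ j, x i j ∘L ContinuousLinearMap.proj j) ∘L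
      (HilbertPow.equiv H k : HilbertPow H k →L[ℂ] (Fin k → H))

variable (H) in
/-- The norms of `M_k(B(H)) = B(ℓ₂ᵏ(H))`. -/
def opMatNorm : MatNorm (H →L[ℂ] H) := fun _ x => ‖amplify x‖ₑ

/-- The norms of `M_k(E) ⊆ M_k(B(H)) = B(ℓ₂ᵏ(H))` for a subspace `E ⊆ B(H)`. -/
def subMatNorm (E : Submodule ℂ (H →L[ℂ] H)) : MatNorm E :=
  fun k x => opMatNorm H k (x.map E.subtype)

/-- The linear map `E → M_k = B(ℓ₂ᵏ)`, `x ↦ (φ_{ij}(x))`, given by a matrix `φ` of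
functionals. -/
def dualMatrixMap (E : Submodule ℂ (H →L[ℂ] H)) {k : ℕ}
    (φ : Matrix (Fin k) (Fin k) (StrongDual ℂ E)) :
    E →ₗ[ℂ] (EuclideanSpace ℂ (Fin k) →L[ℂ] EuclideanSpace ℂ (Fin k)) where
  toFun x := Matrix.toEuclideanCLM (𝕜 := ℂ) (Matrix.of fun i j => φ i j x)
  map_add' x y := by
    rw [← map_add]; congr 1; ext i j; simp
  map_smul' c x := by
    rw [RingHom.id_apply, ← map_smul]; congr 1; ext i j; simp

/-- The operator space structure of the dual `E*`: `M_k(E*) = CB(E, M_k)` isometrically. -/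
def dualMatNorm (E : Submodule ℂ (H →L[ℂ] H)) : MatNorm (StrongDual ℂ E) :=
  fun k φ => cbNorm (subMatNorm E) (opMatNorm (EuclideanSpace ℂ (Fin k))) (dualMatrixMap E φ)

end concrete

/-- The Hilbert space `ℓ₂` of square summable complex sequences. -/
abbrev Ell2 : Type := lp (fun _ : ℕ => ℂ) 2

/-- `d_SK(V) = inf d_cb(V, F)` over all (closed) subspaces `F` of the space `K = K(ℓ₂)` of
compact operators on `ℓ₂`. -/
def dSK {V : Type u} [AddCommGroup V] [Module ℂ V] (μ : MatNorm V) : ℝ≥0∞ :=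
  ⨅ (F : Submodule ℂ (Ell2 →L[ℂ] Ell2)) (_ : IsClosed (F : Set (Ell2 →L[ℂ] Ell2)))
    (_ : ∀ T ∈ F, IsCompactOperator T), dCb μ (subMatNorm F)

/-- An operator space: a closed subspace of `B(H)`, `H` a complex Hilbert space. -/
structure OperatorSpace where
  /-- the Hilbert space -/
  H : Type u
  [normed : NormedAddCommGroup H]
  [inner : InnerProductSpace ℂ H]
  [complete : CompleteSpace H]
  /-- the subspace of `B(H)` -/
  space : Submodule ℂ (H →L[ℂ] H)
  isClosed : IsClosed (space : Set (H →L[ℂ] H))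

attribute [instance] OperatorSpace.normed OperatorSpace.inner OperatorSpace.complete

namespace OperatorSpace

/-- The norms of `M_k(E)`. -/
def matNorm (E : OperatorSpace.{u}) : MatNorm E.space := subMatNorm E.space

/-- The norms of `M_k(E*)`. -/
def dual (E : OperatorSpace.{u}) : MatNorm (StrongDual ℂ E.space) := dualMatNorm E.space

end OperatorSpace

/-- Operator spaces of dimension `n`. -/
structure FinOperatorSpace (n : ℕ) extends OperatorSpace.{u} where
  finiteDimensional : FiniteDimensional ℂ space
  finrank_eq : Module.finrank ℂ space = n

/-! ### Elementary facts making `log d_k` and `log d_cb` (pseudo)metrics -/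

section facts

variable {V : Type u} {W : Type v} {X : Type w} [AddCommGroup V] [Module ℂ V]
  [AddCommGroup W] [Module ℂ W] [AddCommGroup X] [Module ℂ X]

/-- Homogeneity, definiteness and finiteness of a family of matrix norms. -/
def IsLawful (μ : MatNorm V) : Prop :=
  ∀ k x, (∀ c : ℂ, μ k (c • x) = ‖c‖ₑ * μ k x) ∧ (μ k x = 0 → x = 0) ∧ μ k x ≠ ⊤

lemma levelNorm_comp_le {μ : MatNorm V} {ν : MatNorm W} {ρ : MatNorm X}
    (hν : IsLawful ν) (hρ : IsLawful ρ) (k : ℕ) (u : V →ₗ[ℂ] W) (v : W →ₗ[ℂ] X) :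
    levelNorm μ ρ k (v ∘ₗ u) ≤ levelNorm ν ρ k v * levelNorm μ ν k u := by
  refine iSup₂_le fun x hx => ?_
  have hmap : x.map (v ∘ₗ u) = (x.map u).map v := by ext; simp
  have hu : ν k (x.map u) ≤ levelNorm μ ν k u := le_iSup₂_of_le x hx le_rfl
  rw [hmap]
  refine le_trans ?_ (mul_le_mul_right hu _)
  set y := x.map u with hy
  by_cases h0 : ν k y = 0
  · have hy0 : y = 0 := (hν k y).2.1 h0
    have h2 : ρ k (y.map v) = 0 := by
      have h3 : y.map v = (0 : ℂ) • y.map v := by rw [hy0]; ext; simp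
      rw [h3, (hρ k _).1]; simp
    simp [h2]
  have htop : ν k y ≠ ⊤ := (hν k y).2.2
  set c : ℂ := (((ν k y).toReal⁻¹ : ℝ) : ℂ) with hc
  have hcn : ‖c‖ₑ = (ν k y)⁻¹ := by
    have hpos : 0 < (ν k y).toReal := ENNReal.toReal_pos h0 htop
    rw [hc, ← ofReal_norm, Complex.norm_real, Real.norm_of_nonneg (by positivity),
      ENNReal.ofReal_inv_of_pos hpos, ENNReal.ofReal_toReal htop]
  have h1 : ν k (c • y) ≤ 1 := by
    rw [(hν k y).1, hcn, ENNReal.inv_mul_cancel h0 htop]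
  have h2 : ρ k ((c • y).map v) ≤ levelNorm ν ρ k v := le_iSup₂_of_le (c • y) h1 le_rfl
  have h3 : (c • y).map v = c • y.map v := by ext; simp
  rw [h3, (hρ k _).1, hcn, mul_comm, ← div_eq_mul_inv] at h2
  exact (ENNReal.div_le_iff h0 htop).1 h2

lemma cbNorm_comp_le {μ : MatNorm V} {ν : MatNorm W} {ρ : MatNorm X}
    (hν : IsLawful ν) (hρ : IsLawful ρ) (u : V →ₗ[ℂ] W) (v : W →ₗ[ℂ] X) :
    cbNorm μ ρ (v ∘ₗ u) ≤ cbNorm ν ρ v * cbNorm μ ν u :=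
  iSup₂_le fun k hk => (levelNorm_comp_le hν hρ k u v).trans
    (mul_le_mul' (le_iSup₂_of_le k hk le_rfl) (le_iSup₂_of_le k hk le_rfl))

/-- `max (log d) 0`. For spaces of dimension `n ≥ 1` one has `d_k, d_cb ≥ 1`, so that this is
`log d` there. -/
def logDist (d : ℝ≥0∞) : ℝ≥0∞ := (ENNReal.log d).toENNReal

lemma logDist_mono : Monotone logDist := fun _ _ h =>
  EReal.toENNReal_le_toENNReal (ENNReal.log_monotone h)

lemma logDist_of_le_one {d : ℝ≥0∞} (h : d ≤ 1) : logDist d = 0 :=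
  EReal.toENNReal_of_nonpos (ENNReal.log_le_zero_iff.2 h)

lemma logDist_mul_le (a b : ℝ≥0∞) : logDist (a * b) ≤ logDist a + logDist b := by
  unfold logDist; rw [ENNReal.log_mul_add]; exact EReal.toENNReal_add_le

lemma logDist_iInf {ι : Type*} (f : ι → ℝ≥0∞) : logDist (⨅ i, f i) = ⨅ i, logDist (f i) :=
  Monotone.map_iInf_of_continuousAt
    (EReal.continuous_toENNReal.comp ENNReal.continuous_log).continuousAt logDist_mono
    (by simp [logDist])

lemma dLevel_comm (μ : MatNorm V) (ν : MatNorm W) (k : ℕ) : dLevel μ ν k = dLevel ν μ k :=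
  le_antisymm
    (le_iInf fun u => iInf_le_of_le u.symm (by rw [LinearEquiv.symm_symm, mul_comm]))
    (le_iInf fun u => iInf_le_of_le u.symm (by rw [LinearEquiv.symm_symm, mul_comm]))

lemma dCb_comm (μ : MatNorm V) (ν : MatNorm W) : dCb μ ν = dCb ν μ :=
  le_antisymm
    (le_iInf fun u => iInf_le_of_le u.symm (by rw [LinearEquiv.symm_symm, mul_comm]))
    (le_iInf fun u => iInf_le_of_le u.symm (by rw [LinearEquiv.symm_symm, mul_comm]))

lemma CompletelyIsometric.symm {μ : MatNorm V} {ν : MatNorm W}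
    (h : CompletelyIsometric μ ν) : CompletelyIsometric ν μ := by
  obtain ⟨u, hu⟩ := h
  refine ⟨u.symm, fun k x => ?_⟩
  rw [← hu]; congr 1; ext; simp

lemma CompletelyIsometric.levelNorm_le {μ : MatNorm V} {ν : MatNorm W} {u : V ≃ₗ[ℂ] W}
    (hu : ∀ (k : ℕ) (x : Matrix (Fin k) (Fin k) V), ν k (x.map u) = μ k x) (k : ℕ) :
    levelNorm μ ν k u.toLinearMap ≤ 1 ∧ levelNorm ν μ k u.symm.toLinearMap ≤ 1 := by
  refine ⟨iSup₂_le fun x hx => (hu k x).trans_le hx, iSup₂_le fun x hx => le_trans ?_ hx⟩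
  rw [← hu]; refine le_of_eq ?_; congr 1; ext; simp

lemma CompletelyIsometric.dLevel_le {μ : MatNorm V} {ν : MatNorm W}
    (h : CompletelyIsometric μ ν) (k : ℕ) : dLevel μ ν k ≤ 1 := by
  obtain ⟨u, hu⟩ := h
  exact iInf_le_of_le u (mul_le_one' (levelNorm_le hu k).1 (levelNorm_le hu k).2)

lemma CompletelyIsometric.dCb_le {μ : MatNorm V} {ν : MatNorm W}
    (h : CompletelyIsometric μ ν) : dCb μ ν ≤ 1 := by
  obtain ⟨u, hu⟩ := h
  exact iInf_le_of_le u (mul_le_one' (iSup₂_le fun k _ => (levelNorm_le hu k).1)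
    (iSup₂_le fun k _ => (levelNorm_le hu k).2))

lemma CompletelyIsometric.refl (μ : MatNorm V) : CompletelyIsometric μ μ :=
  ⟨LinearEquiv.refl ℂ V, fun k x => by congr 1⟩

lemma CompletelyIsometric.trans {μ : MatNorm V} {ν : MatNorm W} {ρ : MatNorm X}
    (h : CompletelyIsometric μ ν) (h' : CompletelyIsometric ν ρ) : CompletelyIsometric μ ρ := by
  obtain ⟨u, hu⟩ := h
  obtain ⟨v, hv⟩ := h'
  refine ⟨u.trans v, fun k x => ?_⟩
  rw [← hu, ← hv]; congr 1

lemma logDist_dLevel_triangle {μ : MatNorm V} {ν : MatNorm W} {ρ : MatNorm X}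
    (hμ : IsLawful μ) (hν : IsLawful ν) (hρ : IsLawful ρ) (k : ℕ) :
    logDist (dLevel μ ρ k) ≤ logDist (dLevel μ ν k) + logDist (dLevel ν ρ k) := by
  rw [dLevel, dLevel, dLevel, logDist_iInf, logDist_iInf, logDist_iInf]
  refine ENNReal.le_iInf_add_iInf fun u v => iInf_le_of_le (u.trans v) ?_
  refine le_trans (logDist_mono ?_) (logDist_mul_le _ _)
  refine (mul_le_mul' (levelNorm_comp_le hν hρ k u.toLinearMap v.toLinearMap)
    (levelNorm_comp_le hν hμ k v.symm.toLinearMap u.symm.toLinearMap)).trans_eq ?_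
  ring

lemma logDist_dCb_triangle {μ : MatNorm V} {ν : MatNorm W} {ρ : MatNorm X}
    (hμ : IsLawful μ) (hν : IsLawful ν) (hρ : IsLawful ρ) :
    logDist (dCb μ ρ) ≤ logDist (dCb μ ν) + logDist (dCb ν ρ) := by
  rw [dCb, dCb, dCb, logDist_iInf, logDist_iInf, logDist_iInf]
  refine ENNReal.le_iInf_add_iInf fun u v => iInf_le_of_le (u.trans v) ?_
  refine le_trans (logDist_mono ?_) (logDist_mul_le _ _)
  refine (mul_le_mul' (cbNorm_comp_le hν hρ u.toLinearMap v.toLinearMap)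
    (cbNorm_comp_le hν hμ v.symm.toLinearMap u.symm.toLinearMap)).trans_eq ?_
  ring

end facts

lemma HilbertPow.norm_sq {H : Type u} [NormedAddCommGroup H] [InnerProductSpace ℂ H] {k : ℕ}
    (ξ : HilbertPow H k) : ‖ξ‖ ^ 2 = ∑ i, ‖HilbertPow.equiv H k ξ i‖ ^ 2 :=
  PiLp.norm_sq_eq_of_L2 (fun _ : Fin k => H) ξ

lemma amplify_apply {H : Type u} [NormedAddCommGroup H] [InnerProductSpace ℂ H] {k : ℕ}
    (x : Matrix (Fin k) (Fin k) (H →L[ℂ] H)) (ξ : HilbertPow H k) (i : Fin k) :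
    HilbertPow.equiv H k (amplify x ξ) i = ∑ j, x i j (HilbertPow.equiv H k ξ j) := by
  simp [amplify]

lemma isLawful_subMatNorm {H : Type u} [NormedAddCommGroup H] [InnerProductSpace ℂ H]
    (E : Submodule ℂ (H →L[ℂ] H)) : IsLawful (subMatNorm E) := by
  intro k x
  refine ⟨fun c => ?_, fun h => ?_, enorm_ne_top⟩
  · have h1 : amplify ((c • x).map E.subtype) = c • amplify (x.map E.subtype) := by
      ext1 ξ
      apply (HilbertPow.equiv H k).injective
      ext i
      rw [amplify_apply]
      simp [amplify_apply, Finset.smul_sum]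
    simp only [subMatNorm, opMatNorm]
    rw [h1, enorm_smul]
  · have h1 : amplify (x.map E.subtype) = 0 := by
      simp only [subMatNorm, opMatNorm] at h
      rw [← ofReal_norm, ENNReal.ofReal_eq_zero] at h
      exact norm_le_zero_iff.1 h
    ext i j ξ
    have h2 := amplify_apply (x.map E.subtype)
      ((HilbertPow.equiv H k).symm (Pi.single j ξ)) i
    rw [h1, Finset.sum_eq_single j] at h2
    · simpa using h2.symm
    · intro b _ hb; simp [Pi.single_eq_of_ne hb]
    · simp

/-! ### The space `OS_n` and its two topologies -/

/-- Two `n`-dimensional operator spaces are identified if they are completely isometric. -/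
instance finSetoid (n : ℕ) : Setoid (FinOperatorSpace.{u} n) where
  r E F := CompletelyIsometric E.matNorm F.matNorm
  iseqv := ⟨fun E => .refl E.matNorm, fun h => h.symm, fun h h' => h.trans h'⟩

/-- `OS_n`: the set of all `n`-dimensional operator spaces up to complete isometry. -/
def OS (n : ℕ) : Type (u + 1) := Quotient (finSetoid.{u} n)

/-- The class of an `n`-dimensional operator space in `OS_n`. -/
def OS.mk {n : ℕ} (E : FinOperatorSpace.{u} n) : OS.{u} n := Quotient.mk _ E

/-- A distance on `n`-dimensional operator spaces that satisfies the triangle inequality, is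
symmetric, and vanishes on completely isometric spaces, as a distance on `OS_n`. -/
@[reducible] def OS.pseudoEMetric {n : ℕ}
    (d : FinOperatorSpace.{u} n → FinOperatorSpace.{u} n → ℝ≥0∞)
    (h0 : ∀ E F, CompletelyIsometric E.matNorm F.matNorm → d E F = 0)
    (hcomm : ∀ E F, d E F = d F E)
    (htri : ∀ E F G, d E G ≤ d E F + d F G) : PseudoEMetricSpace (OS.{u} n) where
  edist := Quotient.lift₂ d (by
    have key : ∀ E F E' F', CompletelyIsometric E.matNorm E'.matNorm →
        CompletelyIsometric F.matNorm F'.matNorm → d E F ≤ d E' F' := by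
      intro E F E' F' hE hF
      refine (htri E E' F).trans ?_
      rw [h0 _ _ hE, zero_add]
      refine (htri E' F' F).trans ?_
      rw [h0 _ _ hF.symm, add_zero]
    intro E F E' F' hE hF
    exact le_antisymm (key _ _ _ _ hE hF) (key _ _ _ _ hE.symm hF.symm))
  edist_self := by rintro ⟨E⟩; exact h0 E E (.refl _)
  edist_comm := by rintro ⟨E⟩ ⟨F⟩; exact hcomm E F
  edist_triangle := by rintro ⟨E⟩ ⟨F⟩ ⟨G⟩; exact htri E F G

/-- The distance `log d_cb` on `OS_n`. -/
@[reducible] def OS.cbMetric (n : ℕ) : PseudoEMetricSpace (OS.{u} n) :=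
  OS.pseudoEMetric (fun E F => logDist (dCb E.matNorm F.matNorm))
    (fun _ _ h => logDist_of_le_one h.dCb_le)
    (fun _ _ => by rw [dCb_comm])
    (fun _ _ _ => logDist_dCb_triangle (isLawful_subMatNorm _) (isLawful_subMatNorm _)
      (isLawful_subMatNorm _))

/-- The distance `log d_k` on `OS_n`. -/
@[reducible] def OS.levelMetric (n k : ℕ) : PseudoEMetricSpace (OS.{u} n) :=
  OS.pseudoEMetric (fun E F => logDist (dLevel E.matNorm F.matNorm k))
    (fun _ _ h => logDist_of_le_one (h.dLevel_le k))
    (fun _ _ => by rw [dLevel_comm])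
    (fun _ _ _ => logDist_dLevel_triangle (isLawful_subMatNorm _) (isLawful_subMatNorm _)
      (isLawful_subMatNorm _) k)

/-- The topology of the metric `log d_cb` on `OS_n`. -/
@[reducible] def OS.cbTopology (n : ℕ) : TopologicalSpace (OS.{u} n) :=
  (OS.cbMetric n).toUniformSpace.toTopologicalSpace

/-- The weak topology on `OS_n`: the topology defined by the distances `log d_k`, `k ≥ 1`
(the coarsest topology finer than the topology of each of them). -/
@[reducible] def OS.weakTopology (n : ℕ) : TopologicalSpace (OS.{u} n) :=
  ⨅ (k : ℕ) (_ : 1 ≤ k), (OS.levelMetric n k).toUniformSpace.toTopologicalSpace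

end OpSpace

end

open scoped NNReal

noncomputable section

namespace OpSpace

/-! ### Norms of operator matrices and multiplication by scalar contractions -/

section amplify

variable {H : Type*} [NormedAddCommGroup H] [InnerProductSpace ℂ H]
  {H' : Type*} [NormedAddCommGroup H'] [InnerProductSpace ℂ H']

/-! Everything rests on comparing the cb norm with the norm at one fixed level. Testing a `k × k`
operator matrix on vectors involves only `k` vectors at a time, and these span at most `k`
dimensions. Hence a map into `M_k` has its cb norm attained at level `k` (Smith's lemma; here
`pairNorm_le_of_sandwich` and `polarNorm_le_of_level`). The same fact shows that passing to the
adjoint does not increase the norm at any given level (`levelNorm_adjoint_le`), and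
finite-dimensional compressions show that a concrete operator space is completely isometric to its
bidual (`polarNorm_polarNorm_subMatNorm`).

Sufficiency. If `d_SK(E) = 1`, then `E` is almost completely isometric to a finite-dimensional space
of compact operators. Cutting these down by one finite-rank projection barely changes the matrix
norms, uniformly in the level, so `E` almost embeds in some `M_N`. By Smith's lemma, `‖u‖_cb` is at
most a constant close to 1 times `‖u‖_N` for every `u : X → E`, with `N` independent of `X`
(`exists_cbNorm_le_levelNorm`). For `u⁻¹ : E → X` the same is applied to its adjoint `X* → E*`,
using `d_SK(E*) = 1`. So `d_cb(X, E)` is almost dominated by `d_k(X, E)` for a single `k`, and this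
gives continuity.

Necessity. Since `d_k` increases with `k`, continuity at `E` says: for each `c > 1` there are `k`
and `c' > 1` such that `d_k(X, E) ≤ c'` implies `d_cb(X, E) < c`. The norm of `M_k(E)` is a supremum
of norms of matrix-valued maps, and compactness of the unit sphere leaves only finitely many of them
up to the factor `c'` (`IsBddSep.exists_finset`). Their direct sum is a space `X` of operators on a
finite-dimensional Hilbert space, hence of compact operators, with `d_k(X, E) ≤ c'`; so `d_SK(E) <
c`. For `E*`, the norm of `M_k(E*)` is approximated in the same way, and the hypothesis is applied
to the predual of the resulting space. Dualizing the estimate back gives `d_SK(E*) < c`. -/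

lemma sum_sq_amplify_le {k : ℕ} (x : Matrix (Fin k) (Fin k) (H →L[ℂ] H)) (ξ : Fin k → H) :
    ∑ i, ‖∑ j, x i j (ξ j)‖ ^ 2 ≤ ‖amplify x‖ ^ 2 * ∑ j, ‖ξ j‖ ^ 2 := by
  have h := (amplify x).le_opNorm ((HilbertPow.equiv H k).symm ξ)
  have h2 := pow_le_pow_left₀ (norm_nonneg _) h 2
  rw [mul_pow, HilbertPow.norm_sq, HilbertPow.norm_sq] at h2
  simpa [amplify_apply] using h2

lemma norm_amplify_le {k : ℕ} {x : Matrix (Fin k) (Fin k) (H →L[ℂ] H)} {C : ℝ} (hC : 0 ≤ C)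
    (h : ∀ ξ : Fin k → H, ∑ i, ‖∑ j, x i j (ξ j)‖ ^ 2 ≤ C ^ 2 * ∑ j, ‖ξ j‖ ^ 2) :
    ‖amplify x‖ ≤ C := by
  refine ContinuousLinearMap.opNorm_le_bound _ hC fun ξ => ?_
  rw [← sq_le_sq₀ (norm_nonneg _) (by positivity), mul_pow, HilbertPow.norm_sq, HilbertPow.norm_sq]
  simpa [amplify_apply] using h (HilbertPow.equiv H k ξ)

lemma amplify_add {k : ℕ} (x y : Matrix (Fin k) (Fin k) (H →L[ℂ] H)) :
    amplify (x + y) = amplify x + amplify y := by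
  ext1 ξ
  apply (HilbertPow.equiv H k).injective
  ext i
  rw [amplify_apply]
  simp [amplify_apply, Finset.sum_add_distrib]

lemma amplify_smul {k : ℕ} (c : ℂ) (x : Matrix (Fin k) (Fin k) (H →L[ℂ] H)) :
    amplify (c • x) = c • amplify x := by
  ext1 ξ
  apply (HilbertPow.equiv H k).injective
  ext i
  rw [amplify_apply]
  simp [amplify_apply, Finset.smul_sum]

variable (H) in
/-- The linear map `M_k(B(H)) → B(ℓ₂ᵏ(H))`. -/
def amplifyLM (k : ℕ) :
    Matrix (Fin k) (Fin k) (H →L[ℂ] H) →ₗ[ℂ] (HilbertPow H k →L[ℂ] HilbertPow H k) where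
  toFun := amplify
  map_add' := amplify_add
  map_smul' := amplify_smul

@[simp]
lemma amplifyLM_apply {k : ℕ} (x : Matrix (Fin k) (Fin k) (H →L[ℂ] H)) :
    amplifyLM H k x = amplify x := rfl

/-- A scalar matrix is a contraction from `ℓ₂ᵏ` to `ℓ₂ᵐ`. -/
def IsContr {m k : ℕ} (a : Matrix (Fin m) (Fin k) ℂ) : Prop :=
  ∀ ξ : Fin k → ℂ, ∑ i, ‖∑ j, a i j * ξ j‖ ^ 2 ≤ ∑ j, ‖ξ j‖ ^ 2

/-- In an orthonormal basis of the span of the `ξ j`, the scalar inequality applies to each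
coordinate separately, and the results add up. -/
lemma sum_sq_smul_le {m k : ℕ} {a : Matrix (Fin m) (Fin k) ℂ} {C : ℝ}
    (ha : ∀ ξ : Fin k → ℂ, ∑ i, ‖∑ j, a i j * ξ j‖ ^ 2 ≤ C * ∑ j, ‖ξ j‖ ^ 2)
    (ξ : Fin k → H) : ∑ i, ‖∑ j, a i j • ξ j‖ ^ 2 ≤ C * ∑ j, ‖ξ j‖ ^ 2 := by
  set S := Submodule.span ℂ (Set.range ξ)
  have : FiniteDimensional ℂ S := FiniteDimensional.span_of_finite ℂ (Set.finite_range ξ)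
  let b := stdOrthonormalBasis ℂ S
  let η : Fin k → S := fun j => ⟨ξ j, Submodule.subset_span ⟨j, rfl⟩⟩
  have h1 : ∀ j, ‖ξ j‖ ^ 2 = ∑ r, ‖inner ℂ (b r) (η j)‖ ^ 2 := fun j =>
    (b.sum_sq_norm_inner_right (η j)).symm
  have h2 : ∀ i, ‖∑ j, a i j • ξ j‖ ^ 2 = ∑ r, ‖∑ j, a i j * inner ℂ (b r) (η j)‖ ^ 2 := by
    intro i
    have h3 := b.sum_sq_norm_inner_right (∑ j, a i j • η j)
    have h4 : ‖∑ j, a i j • η j‖ = ‖∑ j, a i j • ξ j‖ := by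
      rw [S.coe_norm]
      simp [η]
    rw [← h4, ← h3]
    simp [inner_sum, inner_smul_right]
  simp_rw [h1, h2]
  rw [Finset.sum_comm, Finset.sum_comm (s := (Finset.univ : Finset (Fin k))), Finset.mul_sum]
  exact Finset.sum_le_sum fun r _ => ha _

lemma IsContr.sum_sq_le {m k : ℕ} {a : Matrix (Fin m) (Fin k) ℂ} (ha : IsContr a)
    (ξ : Fin k → H) : ∑ i, ‖∑ j, a i j • ξ j‖ ^ 2 ≤ ∑ j, ‖ξ j‖ ^ 2 := by
  simpa using sum_sq_smul_le (C := 1) (fun η => by simpa using ha η) ξ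

/-- The product `b x a` of a matrix over a vector space with scalar matrices. -/
def sandwich {V : Type*} [AddCommGroup V] [Module ℂ V] {m k : ℕ} (b : Matrix (Fin m) (Fin k) ℂ)
    (x : Matrix (Fin k) (Fin k) V) (a : Matrix (Fin k) (Fin m) ℂ) : Matrix (Fin m) (Fin m) V :=
  Matrix.of fun i j => ∑ p, ∑ q, (b i p * a q j) • x p q

lemma sandwich_map {V W : Type*} [AddCommGroup V] [Module ℂ V] [AddCommGroup W] [Module ℂ W]
    {m k : ℕ} (b : Matrix (Fin m) (Fin k) ℂ) (x : Matrix (Fin k) (Fin k) V)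
    (a : Matrix (Fin k) (Fin m) ℂ) (u : V →ₗ[ℂ] W) :
    (sandwich b x a).map u = sandwich b (x.map u) a := by
  ext i j; simp [sandwich]

lemma sum_sandwich_apply {m k : ℕ} (b : Matrix (Fin m) (Fin k) ℂ)
    (x : Matrix (Fin k) (Fin k) (H →L[ℂ] H)) (a : Matrix (Fin k) (Fin m) ℂ) (ξ : Fin m → H)
    (i : Fin m) :
    ∑ j, sandwich b x a i j (ξ j) = ∑ p, b i p • ∑ q, x p q (∑ j, a q j • ξ j) := by
  simp only [sandwich, Matrix.of_apply, FunLike.coe_sum, Finset.sum_apply,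
    FunLike.coe_smul, Pi.smul_apply, map_sum, map_smul, Finset.smul_sum, smul_smul]
  rw [Finset.sum_comm]
  refine Finset.sum_congr rfl fun p _ => ?_
  rw [Finset.sum_comm]

lemma norm_amplify_sandwich_le {m k : ℕ} {b : Matrix (Fin m) (Fin k) ℂ}
    {a : Matrix (Fin k) (Fin m) ℂ} (hb : IsContr b) (ha : IsContr a)
    (x : Matrix (Fin k) (Fin k) (H →L[ℂ] H)) : ‖amplify (sandwich b x a)‖ ≤ ‖amplify x‖ := by
  refine norm_amplify_le (norm_nonneg _) fun ξ => ?_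
  simp_rw [sum_sandwich_apply]
  exact (hb.sum_sq_le _).trans ((sum_sq_amplify_le x _).trans (by gcongr; exact ha.sum_sq_le ξ))

lemma norm_amplify_conj_le {k : ℕ} (A : H →L[ℂ] H') (B : H' →L[ℂ] H)
    (x : Matrix (Fin k) (Fin k) (H →L[ℂ] H)) :
    ‖amplify (x.map fun T => A ∘L T ∘L B)‖ ≤ ‖A‖ * ‖amplify x‖ * ‖B‖ := by
  refine norm_amplify_le (by positivity) fun ξ => ?_
  have h1 : ∀ i, ∑ j, (x.map fun T => A ∘L T ∘L B) i j (ξ j) = A (∑ j, x i j (B (ξ j))) := by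
    intro i; simp
  simp_rw [h1]
  calc ∑ i, ‖A (∑ j, x i j (B (ξ j)))‖ ^ 2
      ≤ ∑ i, ‖A‖ ^ 2 * ‖∑ j, x i j (B (ξ j))‖ ^ 2 := by
        gcongr with i; rw [← mul_pow]; gcongr; exact A.le_opNorm _
    _ = ‖A‖ ^ 2 * ∑ i, ‖∑ j, x i j (B (ξ j))‖ ^ 2 := by rw [Finset.mul_sum]
    _ ≤ ‖A‖ ^ 2 * (‖amplify x‖ ^ 2 * ∑ j, ‖B (ξ j)‖ ^ 2) := by
        gcongr; exact sum_sq_amplify_le x _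
    _ ≤ ‖A‖ ^ 2 * (‖amplify x‖ ^ 2 * ∑ j, ‖B‖ ^ 2 * ‖ξ j‖ ^ 2) := by
        gcongr with j; rw [← mul_pow]; gcongr; exact B.le_opNorm _
    _ = _ := by rw [← Finset.mul_sum]; ring

lemma norm_entry_le {k : ℕ} (x : Matrix (Fin k) (Fin k) (H →L[ℂ] H)) (p q : Fin k) :
    ‖x p q‖ ≤ ‖amplify x‖ := by
  refine ContinuousLinearMap.opNorm_le_bound _ (norm_nonneg _) fun ξ => ?_
  have h := sum_sq_amplify_le x (Pi.single q ξ)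
  have h1 : ∀ i, ∑ j, x i j ((Pi.single q ξ : Fin k → H) j) = x i q ξ := by
    intro i
    rw [Finset.sum_eq_single q] <;> simp +contextual [Pi.single_eq_of_ne]
  have h2 : ∑ j, ‖(Pi.single q ξ : Fin k → H) j‖ ^ 2 = ‖ξ‖ ^ 2 := by
    rw [Finset.sum_eq_single q] <;> simp +contextual [Pi.single_eq_of_ne]
  simp_rw [h1] at h
  rw [h2, ← mul_pow] at h
  rw [← sq_le_sq₀ (norm_nonneg _) (by positivity)]
  exact (Finset.single_le_sum (f := fun i => ‖x i q ξ‖ ^ 2) (fun i _ => by positivity)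
    (Finset.mem_univ p)).trans h

end amplify

/-! ### Reduction of the size of matrices -/

/-- The columns of `a` are an orthonormal basis of the span of the `f j`, completed by zero columns,
so `a a*` is the orthogonal projection onto that span. This is the dimension count behind Smith's
lemma. -/
lemma exists_contr_of_span {m k : ℕ} (f : Fin k → EuclideanSpace ℂ (Fin m)) :
    ∃ a : Matrix (Fin m) (Fin k) ℂ, IsContr a ∧ IsContr a.conjTranspose ∧
      ∀ j i, ∑ r, a i r * ∑ p, a.conjTranspose r p * f j p = f j i := by
  set S := Submodule.span ℂ (Set.range f) with hS
  have hfS : ∀ j, f j ∈ S := fun j => Submodule.subset_span ⟨j, rfl⟩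
  have hd : Module.finrank ℂ S ≤ k := by
    simpa [Set.finrank] using finrank_range_le_card (R := ℂ) f
  clear_value S
  let b := stdOrthonormalBasis ℂ S
  clear_value b
  generalize Module.finrank ℂ S = d at b hd
  obtain ⟨e, he⟩ := Nat.exists_eq_add_of_le hd
  let a : Matrix (Fin m) (Fin k) ℂ := fun i j =>
    Fin.append (fun r => (b r : EuclideanSpace ℂ (Fin m)) i) (fun _ : Fin e => 0) (Fin.cast he j)
  have hsum : ∀ {M : Type} [AddCommMonoid M] (g : Fin k → M),
      ∑ j, g j = ∑ r : Fin d, g (Fin.cast he.symm (Fin.castAdd e r)) +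
        ∑ s : Fin e, g (Fin.cast he.symm (Fin.natAdd d s)) := by
    intro M _ g
    rw [← Fin.sum_univ_add (fun j => g (Fin.cast he.symm j))]
    exact (Equiv.sum_comp (finCongr he.symm) g).symm
  have ha1 : ∀ i r, a i (Fin.cast he.symm (Fin.castAdd e r)) =
      (b r : EuclideanSpace ℂ (Fin m)) i := by
    intro i r; simp [a]
  have ha2 : ∀ i s, a i (Fin.cast he.symm (Fin.natAdd d s)) = 0 := by
    intro i s; simp [a]
  have hinner : ∀ (r : Fin d) (ξ : EuclideanSpace ℂ (Fin m)),
      ∑ p, starRingEnd ℂ ((b r : EuclideanSpace ℂ (Fin m)) p) * ξ p =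
        inner ℂ (b r : EuclideanSpace ℂ (Fin m)) ξ := by
    intro r ξ
    simp [PiLp.inner_apply, mul_comm]
  refine ⟨a, fun ξ => ?_, fun ξ => ?_, fun j i => ?_⟩
  · have h1 : ∀ i, ∑ j, a i j * ξ j =
        (∑ r, ξ (Fin.cast he.symm (Fin.castAdd e r)) • (b r : EuclideanSpace ℂ (Fin m))) i := by
      intro i; rw [hsum]; simp [ha1, ha2, mul_comm]
    simp_rw [h1]
    rw [← EuclideanSpace.norm_sq_eq]
    have h2 := (b.repr.symm.norm_map
      (WithLp.toLp 2 fun r => ξ (Fin.cast he.symm (Fin.castAdd e r))))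
    rw [← b.sum_repr_symm] at h2
    have h3 : ‖∑ r, ξ (Fin.cast he.symm (Fin.castAdd e r)) • (b r : EuclideanSpace ℂ (Fin m))‖ =
        ‖∑ r, ξ (Fin.cast he.symm (Fin.castAdd e r)) • b r‖ := by
      rw [S.coe_norm]
      simp
    rw [h3]
    simp only [] at h2
    rw [h2, EuclideanSpace.norm_sq_eq, hsum (fun j => ‖ξ j‖ ^ 2)]
    exact le_add_of_nonneg_right (Finset.sum_nonneg fun _ _ => by positivity)
  · rw [hsum]
    simp only [Matrix.conjTranspose_apply, ha1, ha2]
    simp only [RCLike.star_def]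
    have h4 := b.orthonormal.comp_linearIsometry S.subtypeₗᵢ
    have h5 := h4.sum_inner_products_le (WithLp.toLp 2 ξ) (s := Finset.univ)
    rw [EuclideanSpace.norm_sq_eq] at h5
    have h6 : ∀ r, ∑ p, starRingEnd ℂ ((b r : EuclideanSpace ℂ (Fin m)) p) * ξ p =
        inner ℂ (b r : EuclideanSpace ℂ (Fin m)) (WithLp.toLp 2 ξ) :=
      fun r => hinner r (WithLp.toLp 2 ξ)
    simp_rw [h6]
    simpa using h5
  · rw [hsum]
    simp only [Matrix.conjTranspose_apply, ha1, ha2]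
    simp only [RCLike.star_def, hinner]
    have h7 := b.sum_repr' ⟨f j, hfS j⟩
    have h8 := congrArg (fun z : S => (z : EuclideanSpace ℂ (Fin m)) i) h7
    simp only [AddSubmonoidClass.coe_finsetSum, Submodule.coe_smul] at h8
    simp at h8
    simp [← h8, mul_comm]

/-- The matrix of the inclusion of the first `j` coordinates into `k` coordinates. -/
def padMatrix (j k : ℕ) : Matrix (Fin k) (Fin j) ℂ :=
  Matrix.of fun p i => if (p : ℕ) = i then 1 else 0

lemma isContr_padMatrix (j k : ℕ) : IsContr (padMatrix j k) := by
  intro ξ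
  have h : ∀ p : Fin k, ∑ i, padMatrix j k p i * ξ i = if h : (p : ℕ) < j then ξ ⟨p, h⟩ else 0 := by
    intro p
    split_ifs with h
    · rw [Finset.sum_eq_single ⟨p, h⟩]
      · simp [padMatrix]
      · intro b _ hb
        have : (p : ℕ) ≠ b := fun h' => hb (Fin.ext h'.symm)
        simp [padMatrix, this]
      · simp
    · refine Finset.sum_eq_zero fun i _ => ?_
      have : (p : ℕ) ≠ i := fun h' => h (h' ▸ i.2)
      simp [padMatrix, this]
  simp_rw [h]
  let g : ℕ → ℝ := fun q => ‖(if h : q < j then ξ ⟨q, h⟩ else 0 : ℂ)‖ ^ 2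
  have h2 : ∀ p : Fin j, ‖ξ p‖ ^ 2 = g p := fun p => by simp [g]
  rw [Finset.sum_congr rfl fun p _ => h2 p, Fin.sum_univ_eq_sum_range g j,
    show ∑ p : Fin k, ‖(if h : (p : ℕ) < j then ξ ⟨p, h⟩ else 0 : ℂ)‖ ^ 2 =
      ∑ p : Fin k, g p from rfl,
    Fin.sum_univ_eq_sum_range g k]
  rcases le_total k j with hkj | hkj
  · exact Finset.sum_le_sum_of_subset_of_nonneg (Finset.range_mono hkj) fun _ _ _ => by positivity
  · refine (Finset.sum_subset (Finset.range_mono hkj) fun q _ hq => ?_).ge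
    simp at hq
    simp [g, not_lt.2 hq]

lemma sandwich_padMatrix {V : Type*} [AddCommGroup V] [Module ℂ V] {j k : ℕ} (hjk : j ≤ k)
    (x : Matrix (Fin j) (Fin j) V) :
    sandwich (padMatrix k j) (sandwich (padMatrix j k) x (padMatrix k j)) (padMatrix j k) = x := by
  ext p q
  simp only [sandwich, Matrix.of_apply, padMatrix]
  rw [Finset.sum_eq_single (Fin.castLE hjk p), Finset.sum_eq_single (Fin.castLE hjk q),
    Finset.sum_eq_single p, Finset.sum_eq_single q]
  · simp
  all_goals simp +contextual [Fin.ext_iff, eq_comm]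

lemma opMatNorm_le_iff {H : Type*} [NormedAddCommGroup H] [InnerProductSpace ℂ H] {k : ℕ}
    {x : Matrix (Fin k) (Fin k) (H →L[ℂ] H)} {C : ℝ≥0} :
    opMatNorm H k x ≤ C ↔ ‖amplify x‖ ≤ C := by
  rw [opMatNorm, enorm_le_coe]; rfl

lemma opMatNorm_le_opMatNorm_iff {H H' : Type*} [NormedAddCommGroup H] [InnerProductSpace ℂ H]
    [NormedAddCommGroup H'] [InnerProductSpace ℂ H'] {k m : ℕ}
    {x : Matrix (Fin k) (Fin k) (H →L[ℂ] H)} {y : Matrix (Fin m) (Fin m) (H' →L[ℂ] H')} :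
    opMatNorm H k x ≤ opMatNorm H' m y ↔ ‖amplify x‖ ≤ ‖amplify y‖ :=
  enorm_le_iff_norm_le

/-! ### Matrix norms of finite-dimensional operator spaces -/

section IsOpNorm

variable {V : Type*} {W : Type*} [AddCommGroup V] [Module ℂ V] [AddCommGroup W] [Module ℂ W]

/-- The properties of the matrix norms of a finite-dimensional operator space that are used
below. -/
structure IsOpNorm (μ : MatNorm V) : Prop where
  lawful : IsLawful μ
  sandwich_le : ∀ {m k : ℕ} {b : Matrix (Fin m) (Fin k) ℂ} {a : Matrix (Fin k) (Fin m) ℂ},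
    IsContr b → IsContr a → ∀ x, μ m (sandwich b x a) ≤ μ k x
  bounded : ∀ φ : V →ₗ[ℂ] ℂ, ∃ C : ℝ≥0, ∀ k x p q, ‖φ (x p q)‖ₑ ≤ C * μ k x

lemma exists_enorm_apply_le {F : Type*} [NormedAddCommGroup F] [NormedSpace ℂ F]
    [FiniteDimensional ℂ F] (φ : F →ₗ[ℂ] ℂ) : ∃ C : ℝ≥0, ∀ x, ‖φ x‖ₑ ≤ C * ‖x‖ₑ :=
  ⟨‖LinearMap.toContinuousLinearMap φ‖₊, (LinearMap.toContinuousLinearMap φ).le_opENorm⟩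

lemma isOpNorm_subMatNorm {H : Type*} [NormedAddCommGroup H] [InnerProductSpace ℂ H]
    (E : Submodule ℂ (H →L[ℂ] H)) [FiniteDimensional ℂ E] : IsOpNorm (subMatNorm E) where
  lawful := isLawful_subMatNorm E
  sandwich_le hb ha x := by
    rw [subMatNorm, sandwich_map, subMatNorm, opMatNorm_le_opMatNorm_iff]
    exact norm_amplify_sandwich_le hb ha _
  bounded φ := by
    obtain ⟨C, hC⟩ := exists_enorm_apply_le (F := E) φ
    refine ⟨C, fun k x p q => (hC (x p q)).trans ?_⟩
    refine mul_le_mul' le_rfl ?_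
    rw [subMatNorm, opMatNorm, enorm_le_iff_norm_le]
    exact norm_entry_le (x.map E.subtype) p q

lemma IsOpNorm.of_completelyIsometric {μ : MatNorm V} {ν : MatNorm W} (hν : IsOpNorm ν)
    (h : CompletelyIsometric μ ν) : IsOpNorm μ := by
  obtain ⟨u, hu⟩ := h
  refine ⟨fun k x => ⟨fun c => ?_, fun h0 => ?_, ?_⟩, fun {m k b a} hb ha x => ?_, fun φ => ?_⟩
  · rw [← hu, ← hu, ← (hν.lawful k _).1]; congr 1; ext; simp
  · rw [← hu] at h0
    have h1 := (hν.lawful k _).2.1 h0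
    ext i j
    have := congrFun (congrFun h1 i) j
    simpa using this
  · rw [← hu]; exact (hν.lawful k _).2.2
  · rw [← hu, ← hu]
    have := sandwich_map b x a u.toLinearMap
    exact (congrArg (ν m) this).trans_le (hν.sandwich_le hb ha _)
  · obtain ⟨C, hC⟩ := hν.bounded (φ ∘ₗ u.symm.toLinearMap)
    refine ⟨C, fun k x p q => ?_⟩
    rw [← hu]
    simpa using hC k (x.map u) p q

/-- A matrix can be padded with zeros and then cut back, both by scalar contractions. -/
lemma levelNorm_mono {μ : MatNorm V} {ν : MatNorm W} (hμ : IsOpNorm μ) (hν : IsOpNorm ν)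
    (u : V →ₗ[ℂ] W) {j k : ℕ} (hjk : j ≤ k) : levelNorm μ ν j u ≤ levelNorm μ ν k u := by
  refine iSup₂_le fun x hx => ?_
  refine le_iSup₂_of_le (sandwich (padMatrix j k) x (padMatrix k j))
    ((hμ.sandwich_le (isContr_padMatrix _ _) (isContr_padMatrix _ _) x).trans hx) ?_
  conv_lhs => rw [← sandwich_padMatrix hjk x, sandwich_map]
  exact hν.sandwich_le (isContr_padMatrix _ _) (isContr_padMatrix _ _) _

lemma dLevel_mono {μ : MatNorm V} {ν : MatNorm W} (hμ : IsOpNorm μ) (hν : IsOpNorm ν)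
    {j k : ℕ} (hjk : j ≤ k) : dLevel μ ν j ≤ dLevel μ ν k :=
  iInf_mono fun _ => mul_le_mul' (levelNorm_mono hμ hν _ hjk) (levelNorm_mono hν hμ _ hjk)

lemma le_levelNorm_mul {μ : MatNorm V} {ν : MatNorm W} (hμ : IsLawful μ) (hν : IsLawful ν)
    (u : V →ₗ[ℂ] W) {k : ℕ} (x : Matrix (Fin k) (Fin k) V) :
    ν k (x.map u) ≤ levelNorm μ ν k u * μ k x := by
  by_cases h0 : μ k x = 0
  · have hx := (hμ k x).2.1 h0
    have h3 : x.map u = (0 : ℂ) • x.map u := by rw [hx]; ext; simp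
    rw [h3, (hν k _).1]; simp
  have htop : μ k x ≠ ⊤ := (hμ k x).2.2
  set c : ℂ := (((μ k x).toReal⁻¹ : ℝ) : ℂ) with hc
  have hcn : ‖c‖ₑ = (μ k x)⁻¹ := by
    have hpos : 0 < (μ k x).toReal := ENNReal.toReal_pos h0 htop
    rw [hc, ← ofReal_norm, Complex.norm_real, Real.norm_of_nonneg (by positivity),
      ENNReal.ofReal_inv_of_pos hpos, ENNReal.ofReal_toReal htop]
  have h2 : ν k ((c • x).map u) ≤ levelNorm μ ν k u :=
    le_iSup₂_of_le (c • x) (by rw [(hμ k x).1, hcn, ENNReal.inv_mul_cancel h0 htop]) le_rfl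
  have h3 : (c • x).map u = c • x.map u := by ext; simp
  rw [h3, (hν k _).1, hcn, mul_comm, ← div_eq_mul_inv] at h2
  exact (ENNReal.div_le_iff h0 htop).1 h2

lemma le_cbNorm_mul {μ : MatNorm V} {ν : MatNorm W} (hμ : IsOpNorm μ) (hν : IsOpNorm ν)
    (u : V →ₗ[ℂ] W) {k : ℕ} (x : Matrix (Fin k) (Fin k) V) :
    ν k (x.map u) ≤ cbNorm μ ν u * μ k x := by
  refine (le_levelNorm_mul hμ.lawful hν.lawful u x).trans (mul_le_mul' ?_ le_rfl)
  -- Level `k + 1` covers `k = 0`, which the supremum defining `cbNorm` leaves out.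
  exact (levelNorm_mono hμ hν u (Nat.le_succ k)).trans
    (le_iSup₂_of_le (k + 1) (by lia) le_rfl)

lemma cbNorm_le_of_forall {μ : MatNorm V} {ν : MatNorm W} {u : V →ₗ[ℂ] W} {C : ℝ≥0∞}
    (h : ∀ k (x : Matrix (Fin k) (Fin k) V), ν k (x.map u) ≤ C * μ k x) : cbNorm μ ν u ≤ C :=
  iSup₂_le fun k _ => iSup₂_le fun x hx => (h k x).trans (mul_le_of_le_one_right' hx)

end IsOpNorm

/-! ### Norms defined by duality -/

section polar

variable {V : Type*} {W : Type*} [AddCommGroup V] [Module ℂ V] [AddCommGroup W] [Module ℂ W]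

/-- The matrix norms defined by a family of maps into spaces of operators. -/
def supNorm {ι : Type*} {H : ι → Type*} [∀ i, NormedAddCommGroup (H i)]
    [∀ i, InnerProductSpace ℂ (H i)] (φ : ∀ i, V →ₗ[ℂ] (H i →L[ℂ] H i)) : MatNorm V :=
  fun k x => ⨆ i, opMatNorm (H i) k (x.map (φ i))

/-- The map `W → M_m`, `w ↦ (B(x_{pq}, w))`, given by a bilinear form `B` and a matrix `x`. -/
def evalMap (B : V →ₗ[ℂ] W →ₗ[ℂ] ℂ) {m : ℕ} (x : Matrix (Fin m) (Fin m) V) :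
    W →ₗ[ℂ] (EuclideanSpace ℂ (Fin m) →L[ℂ] EuclideanSpace ℂ (Fin m)) where
  toFun w := Matrix.toEuclideanCLM (𝕜 := ℂ) (Matrix.of fun i j => B (x i j) w)
  map_add' w z := by
    rw [← map_add]; congr 1; ext i j; simp
  map_smul' c w := by
    rw [RingHom.id_apply, ← map_smul]; congr 1; ext i j; simp

lemma evalMap_apply (B : V →ₗ[ℂ] W →ₗ[ℂ] ℂ) {m : ℕ} (x : Matrix (Fin m) (Fin m) V) (w : W)
    (ξ : EuclideanSpace ℂ (Fin m)) (p : Fin m) :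
    evalMap B x w ξ p = ∑ q, B (x p q) w * ξ q := by
  simp [evalMap, Matrix.mulVec, dotProduct]

/-- The size of the matrix `(B(x_{pq}, y_{ij}))`, as a matrix in `M_k(M_m)`. -/
def pairNorm (B : V →ₗ[ℂ] W →ₗ[ℂ] ℂ) {m k : ℕ} (x : Matrix (Fin m) (Fin m) V)
    (y : Matrix (Fin k) (Fin k) W) : ℝ≥0∞ :=
  opMatNorm (EuclideanSpace ℂ (Fin m)) k (y.map (evalMap B x))

/-- The matrices of all sizes of norm at most one. -/
abbrev MatBall (μ : MatNorm V) := Σ m : ℕ, {x : Matrix (Fin m) (Fin m) V // μ m x ≤ 1}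

/-- The matrix norms dual to `μ` with respect to the bilinear form `B`. -/
def polarNorm (B : V →ₗ[ℂ] W →ₗ[ℂ] ℂ) (μ : MatNorm V) : MatNorm W :=
  supNorm fun i : MatBall μ => evalMap B i.2.1

lemma pairNorm_le_polarNorm (B : V →ₗ[ℂ] W →ₗ[ℂ] ℂ) {μ : MatNorm V} {m k : ℕ}
    {x : Matrix (Fin m) (Fin m) V} (hx : μ m x ≤ 1) (y : Matrix (Fin k) (Fin k) W) :
    pairNorm B x y ≤ polarNorm B μ k y :=
  le_iSup (fun i : MatBall μ => opMatNorm _ k (y.map (evalMap B i.2.1))) ⟨m, x, hx⟩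

lemma polarNorm_le (B : V →ₗ[ℂ] W →ₗ[ℂ] ℂ) {μ : MatNorm V} {k : ℕ}
    {y : Matrix (Fin k) (Fin k) W} {C : ℝ≥0∞}
    (h : ∀ m (x : Matrix (Fin m) (Fin m) V), μ m x ≤ 1 → pairNorm B x y ≤ C) :
    polarNorm B μ k y ≤ C :=
  iSup_le fun i => h i.1 i.2.1 i.2.2

lemma sum_sq_evalMap (B : V →ₗ[ℂ] W →ₗ[ℂ] ℂ) {m k : ℕ} (x : Matrix (Fin m) (Fin m) V)
    (y : Matrix (Fin k) (Fin k) W) (ξ : Fin k → EuclideanSpace ℂ (Fin m)) :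
    ∑ i, ‖∑ j, (y.map (evalMap B x)) i j (ξ j)‖ ^ 2 =
      ∑ i, ∑ p, ‖∑ j, ∑ q, B (x p q) (y i j) * ξ j q‖ ^ 2 := by
  simp [EuclideanSpace.norm_sq_eq, evalMap_apply]

/-- Both sides are norms of the same operator on `ℓ₂ᵏ ⊗ ℓ₂ᵐ`, up to exchanging the tensor factors.
-/
lemma pairNorm_flip_le (B : V →ₗ[ℂ] W →ₗ[ℂ] ℂ) {m k : ℕ} (x : Matrix (Fin m) (Fin m) V)
    (y : Matrix (Fin k) (Fin k) W) : pairNorm B x y ≤ pairNorm B.flip y x := by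
  rw [pairNorm, pairNorm, opMatNorm_le_opMatNorm_iff]
  refine norm_amplify_le (norm_nonneg _) fun ξ => ?_
  have h := sum_sq_amplify_le (x.map (evalMap B.flip y)) fun q => WithLp.toLp 2 fun j => ξ j q
  rw [sum_sq_evalMap, Finset.sum_comm] at h ⊢
  simp only [EuclideanSpace.norm_sq_eq] at h ⊢
  rw [Finset.sum_comm (f := fun q j => ‖(ξ j).ofLp q‖ ^ 2)] at h
  refine le_trans (le_of_eq ?_) h
  rw [Finset.sum_comm]
  refine Finset.sum_congr rfl fun i _ => Finset.sum_congr rfl fun p _ => ?_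
  rw [Finset.sum_comm]
  rfl

lemma pairNorm_flip (B : V →ₗ[ℂ] W →ₗ[ℂ] ℂ) {m k : ℕ} (x : Matrix (Fin m) (Fin m) V)
    (y : Matrix (Fin k) (Fin k) W) : pairNorm B.flip y x = pairNorm B x y :=
  le_antisymm (pairNorm_flip_le B.flip y x) (pairNorm_flip_le B x y)

lemma apply_sandwich (B : V →ₗ[ℂ] W →ₗ[ℂ] ℂ) {m k : ℕ} (b : Matrix (Fin m) (Fin k) ℂ)
    (x : Matrix (Fin k) (Fin k) V) (a : Matrix (Fin k) (Fin m) ℂ) (i j : Fin m) (w : W) :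
    B (sandwich b x a i j) w = ∑ p, ∑ q, (b i p * a q j) * B (x p q) w := by
  simp [sandwich]

lemma sum_shuffle {ι κ σ : Type*} [Fintype ι] [Fintype κ] [Fintype σ] (β : ι → ℂ)
    (a : ι → σ → ℂ) (M : ι → ι → κ → ℂ) (η : κ → σ → ℂ) :
    ∑ j, ∑ s, (∑ p, ∑ q, (β p * a q s) * M p q j) * η j s =
      ∑ p, β p * ∑ j, ∑ q, M p q j * ∑ s, a q s * η j s := by
  simp only [Finset.mul_sum, Finset.sum_mul]
  rw [Finset.sum_comm (s := (Finset.univ : Finset ι)) (t := (Finset.univ : Finset κ))]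
  refine Finset.sum_congr rfl fun j _ => ?_
  rw [Finset.sum_comm]
  refine Finset.sum_congr rfl fun p _ => ?_
  rw [Finset.sum_comm]
  exact Finset.sum_congr rfl fun q _ => Finset.sum_congr rfl fun s _ => by ring

/-- The norm of the matrix `(B(x_{pq}, y_{ij}))` can be computed by compressing the matrix `x` to
the size of the matrix `y`. -/
lemma pairNorm_le_of_sandwich (B : V →ₗ[ℂ] W →ₗ[ℂ] ℂ) {m k : ℕ} (x : Matrix (Fin m) (Fin m) V)
    (y : Matrix (Fin k) (Fin k) W) {C : ℝ≥0∞}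
    (h : ∀ (b : Matrix (Fin k) (Fin m) ℂ) (a : Matrix (Fin m) (Fin k) ℂ), IsContr b → IsContr a →
      pairNorm B (sandwich b x a) y ≤ C) : pairNorm B x y ≤ C := by
  induction C using ENNReal.recTopCoe with
  | top => exact le_top
  | coe C =>
  rw [pairNorm, opMatNorm_le_iff]
  refine norm_amplify_le C.2 fun ξ => ?_
  -- The `k` test vectors `ξ` and their `k` images `ζ` each lie in the range of a contraction from
  -- `ℓ₂ᵏ` to `ℓ₂ᵐ`. Compressing `x` by these contractions loses nothing on these vectors.
  obtain ⟨a, ha, ha', haξ⟩ := exists_contr_of_span ξ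
  set ζ : Fin k → EuclideanSpace ℂ (Fin m) :=
    fun i => ∑ j, (y.map (evalMap B x)) i j (ξ j) with hζ
  obtain ⟨b, hb, hb', hbζ⟩ := exists_contr_of_span ζ
  have h1 := h b.conjTranspose a hb' ha
  rw [pairNorm, opMatNorm_le_iff] at h1
  have h2 := sum_sq_amplify_le (y.map (evalMap B (sandwich b.conjTranspose x a)))
    fun j => WithLp.toLp 2 fun r => ∑ p, a.conjTranspose r p * ξ j p
  have h3 : ∀ i, ‖ζ i‖ ^ 2 ≤ ‖∑ j, (y.map (evalMap B (sandwich b.conjTranspose x a))) i j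
      (WithLp.toLp 2 fun r => ∑ p, a.conjTranspose r p * ξ j p)‖ ^ 2 := by
    intro i
    have h4 : ∀ r, (∑ j, (y.map (evalMap B (sandwich b.conjTranspose x a))) i j
        (WithLp.toLp 2 fun r => ∑ p, a.conjTranspose r p * ξ j p)).ofLp r =
        ∑ p, b.conjTranspose r p * ζ i p := by
      intro r
      have h5 : ∀ p, ζ i p = ∑ j, ∑ q, B (x p q) (y i j) *
          ∑ s, a q s * ∑ t, a.conjTranspose s t * ξ j t := by
        intro p
        simp only [haξ]
        simp [hζ, evalMap_apply]
      simp only [h5, Matrix.map_apply, WithLp.ofLp_sum, Finset.sum_apply, evalMap_apply]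
      refine Eq.trans ?_ (sum_shuffle (fun p => b.conjTranspose r p) a
        (fun p q j => B (x p q) (y i j)) fun j s => ∑ t, a.conjTranspose s t * ξ j t)
      exact Finset.sum_congr rfl fun j _ => Finset.sum_congr rfl fun s _ => by
        rw [apply_sandwich]
    rw [EuclideanSpace.norm_sq_eq, EuclideanSpace.norm_sq_eq]
    simp only [h4]
    simpa only [hbζ] using hb fun r => ∑ p, b.conjTranspose r p * ζ i p
  refine (Finset.sum_le_sum fun i _ => h3 i).trans (h2.trans ?_)
  refine mul_le_mul (pow_le_pow_left₀ (norm_nonneg _) h1 2) ?_ (by positivity) (by positivity)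
  refine Finset.sum_le_sum fun j _ => ?_
  rw [EuclideanSpace.norm_sq_eq, EuclideanSpace.norm_sq_eq]
  exact ha' _

/-- Smith's lemma: compressing a matrix of any size to size `k` keeps it in the unit ball, so the
dual norm of a `k × k` matrix needs testing only at level `k`. -/
lemma polarNorm_le_of_level (B : V →ₗ[ℂ] W →ₗ[ℂ] ℂ) {μ : MatNorm V} (hμ : IsOpNorm μ) {k : ℕ}
    {y : Matrix (Fin k) (Fin k) W} {C : ℝ≥0∞}
    (h : ∀ (x : Matrix (Fin k) (Fin k) V), μ k x ≤ 1 → pairNorm B x y ≤ C) :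
    polarNorm B μ k y ≤ C :=
  polarNorm_le B fun _ x hx => pairNorm_le_of_sandwich B x y fun _ _ hb ha =>
    h _ ((hμ.sandwich_le hb ha x).trans hx)

lemma evalMap_smul (B : V →ₗ[ℂ] W →ₗ[ℂ] ℂ) {m : ℕ} (c : ℂ) (x : Matrix (Fin m) (Fin m) V)
    (w : W) : evalMap B (c • x) w = c • evalMap B x w := by
  ext ξ p
  simp [evalMap_apply, Finset.mul_sum, mul_assoc]

lemma pairNorm_smul_left (B : V →ₗ[ℂ] W →ₗ[ℂ] ℂ) {m k : ℕ} (c : ℂ) (x : Matrix (Fin m) (Fin m) V)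
    (y : Matrix (Fin k) (Fin k) W) : pairNorm B (c • x) y = ‖c‖ₑ * pairNorm B x y := by
  rw [pairNorm, pairNorm, opMatNorm, opMatNorm, ← enorm_smul, ← amplify_smul]
  congr 2
  ext1 i j
  simp [evalMap_smul]

lemma pairNorm_le_mul (B : V →ₗ[ℂ] W →ₗ[ℂ] ℂ) {μ : MatNorm V} (hμ : IsLawful μ) {m k : ℕ}
    (x : Matrix (Fin m) (Fin m) V) (y : Matrix (Fin k) (Fin k) W) :
    pairNorm B x y ≤ polarNorm B μ k y * μ m x := by
  by_cases h0 : μ m x = 0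
  · have hx : x = (0 : ℂ) • x := by simp [(hμ m x).2.1 h0]
    rw [hx, pairNorm_smul_left]; simp
  have htop : μ m x ≠ ⊤ := (hμ m x).2.2
  set c : ℂ := (((μ m x).toReal⁻¹ : ℝ) : ℂ) with hc
  have hcn : ‖c‖ₑ = (μ m x)⁻¹ := by
    have hpos : 0 < (μ m x).toReal := ENNReal.toReal_pos h0 htop
    rw [hc, ← ofReal_norm, Complex.norm_real, Real.norm_of_nonneg (by positivity),
      ENNReal.ofReal_inv_of_pos hpos, ENNReal.ofReal_toReal htop]
  have h2 : pairNorm B (c • x) y ≤ polarNorm B μ k y :=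
    pairNorm_le_polarNorm B (by rw [(hμ m x).1, hcn, ENNReal.inv_mul_cancel h0 htop]) y
  rw [pairNorm_smul_left, hcn, mul_comm, ← div_eq_mul_inv] at h2
  exact (ENNReal.div_le_iff h0 htop).1 h2

lemma polarNorm_polarNorm_le (B : V →ₗ[ℂ] W →ₗ[ℂ] ℂ) {μ : MatNorm V} (hμ : IsLawful μ) {m : ℕ}
    (x : Matrix (Fin m) (Fin m) V) : polarNorm B.flip (polarNorm B μ) m x ≤ μ m x :=
  polarNorm_le _ fun k y hy => by
    rw [pairNorm_flip]
    exact (pairNorm_le_mul B hμ x y).trans (mul_le_of_le_one_left' hy)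

/-! ### Adjoint maps -/

section adjoint

variable {V' : Type*} {W' : Type*} [AddCommGroup V'] [Module ℂ V'] [AddCommGroup W'] [Module ℂ W']
  {B : V →ₗ[ℂ] W →ₗ[ℂ] ℂ} {B' : V' →ₗ[ℂ] W' →ₗ[ℂ] ℂ} {u : V →ₗ[ℂ] V'} {u' : W' →ₗ[ℂ] W}

lemma pairNorm_adjoint (h : ∀ v w, B v (u' w) = B' (u v) w) {m k : ℕ}
    (x : Matrix (Fin m) (Fin m) V) (y : Matrix (Fin k) (Fin k) W') :
    pairNorm B x (y.map u') = pairNorm B' (x.map u) y := by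
  rw [pairNorm, pairNorm]
  congr 1
  ext i j ξ p
  simp [evalMap_apply, h]

/-- The dual norm at level `k` is tested on matrices of size `k`, so no level above `k` of `u`
enters. -/
lemma levelNorm_adjoint_le (h : ∀ v w, B v (u' w) = B' (u v) w) {μ : MatNorm V}
    {μ' : MatNorm V'} (hμ : IsOpNorm μ) (hμ' : IsOpNorm μ') (k : ℕ) :
    levelNorm (polarNorm B' μ') (polarNorm B μ) k u' ≤ levelNorm μ μ' k u := by
  refine iSup₂_le fun y hy => polarNorm_le_of_level B hμ fun x hx => ?_
  rw [pairNorm_adjoint h]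
  refine (pairNorm_le_mul B' hμ'.lawful _ y).trans ((mul_le_of_le_one_left' hy).trans ?_)
  exact le_iSup₂_of_le x hx le_rfl

lemma cbNorm_adjoint_le (h : ∀ v w, B v (u' w) = B' (u v) w) {μ : MatNorm V}
    {μ' : MatNorm V'} (hμ : IsOpNorm μ) (hμ' : IsOpNorm μ') :
    cbNorm (polarNorm B' μ') (polarNorm B μ) u' ≤ cbNorm μ μ' u :=
  iSup₂_mono fun k _ => levelNorm_adjoint_le h hμ hμ' k

end adjoint

end polar

lemma opMatNorm_zero (H : Type*) [NormedAddCommGroup H] [InnerProductSpace ℂ H] (k : ℕ) :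
    opMatNorm H k 0 = 0 :=
  nonpos_iff_eq_zero.1 ((opMatNorm_le_iff (C := 0)).2 (norm_amplify_le le_rfl (by simp)))

/-! ### Direct sums of operators -/

section blockDiag

variable {ι : Type*} {H : ι → Type*} [∀ i, NormedAddCommGroup (H i)]

lemma hasSum_norm_sq (f : lp H 2) : HasSum (fun i => ‖f i‖ ^ 2) (‖f‖ ^ 2) := by
  have h := lp.hasSum_norm (p := 2) (by norm_num) f
  norm_num at h
  exact h

variable [∀ i, InnerProductSpace ℂ (H i)] {V : Type*} [AddCommGroup V] [Module ℂ V]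
  (φ : ∀ i, V →ₗ[ℂ] (H i →L[ℂ] H i))

/-- A pointwise bounded and separating family of maps into spaces of operators. -/
structure IsBddSep : Prop where
  bdd : ∀ v, ∃ C : ℝ≥0, ∀ i, ‖φ i v‖ ≤ C
  sep : ∀ v, (∀ i, φ i v = 0) → v = 0

variable {φ}

lemma memℓp_apply (hφ : IsBddSep φ) (v : V) (f : lp H 2) :
    Memℓp (fun i => φ i v (f i)) 2 := by
  obtain ⟨C, hC⟩ := hφ.bdd v
  have h := ((hasSum_norm_sq f).summable.mul_left ((C : ℝ) ^ 2))
  refine memℓp_gen (Summable.of_nonneg_of_le (fun i => by positivity) (fun i => ?_) h)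
  norm_num
  rw [← mul_pow]
  gcongr
  exact (φ i v).le_of_opNorm_le (hC i) _

/-- The direct sum of the operators `φ i v`. -/
def blockDiag (hφ : IsBddSep φ) : V →ₗ[ℂ] (lp H 2 →L[ℂ] lp H 2) where
  toFun v := LinearMap.mkContinuousOfExistsBound
    { toFun := fun f => ⟨fun i => φ i v (f i), memℓp_apply hφ v f⟩
      map_add' := fun f g => by ext i; exact map_add (φ i v) (f i) (g i)
      map_smul' := fun c f => by ext i; exact map_smul (φ i v) c (f i) } (by
      obtain ⟨C, hC⟩ := hφ.bdd v
      refine ⟨C, fun f => ?_⟩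
      rw [← sq_le_sq₀ (norm_nonneg _) (by positivity), mul_pow]
      refine hasSum_le (fun i => ?_) (hasSum_norm_sq _) ((hasSum_norm_sq f).mul_left _)
      rw [← mul_pow]
      gcongr
      exact (φ i v).le_of_opNorm_le (hC i) _)
  map_add' v w := by ext f i; exact congrArg (fun T => T (f i)) (map_add (φ i) v w)
  map_smul' c v := by ext f i; exact congrArg (fun T => T (f i)) (map_smul (φ i) c v)

lemma blockDiag_apply (hφ : IsBddSep φ) (v : V) (f : lp H 2) (i : ι) :
    blockDiag hφ v f i = φ i v (f i) := rfl

/-- The upper bound is obtained summand by summand, adding squared norms; the lower bound by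
compressing to a single summand. -/
lemma opMatNorm_blockDiag (hφ : IsBddSep φ) {k : ℕ} (x : Matrix (Fin k) (Fin k) V) :
    opMatNorm (lp H 2) k (x.map (blockDiag hφ)) = supNorm φ k x := by
  classical
  apply le_antisymm
  · generalize hC : supNorm φ k x = C
    induction C using ENNReal.recTopCoe with
    | top => exact le_top
    | coe C =>
    have hi : ∀ i, ‖amplify (x.map (φ i))‖ ≤ C := fun i => by
      rw [← opMatNorm_le_iff, ← hC]
      exact le_iSup (fun i => opMatNorm (H i) k (x.map (φ i))) i
    rw [opMatNorm_le_iff]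
    refine norm_amplify_le C.2 fun ξ => ?_
    refine hasSum_le (fun i => ?_) (hasSum_sum fun p _ => hasSum_norm_sq _)
      ((hasSum_sum fun q _ => hasSum_norm_sq (ξ q)).mul_left _)
    have h := sum_sq_amplify_le (x.map (φ i)) fun q => ξ q i
    refine le_trans (le_of_eq ?_) (h.trans ?_)
    · refine Finset.sum_congr rfl fun p _ => ?_
      congr 2
      exact (map_sum (lp.evalₗ (𝕜 := ℂ) H 2 i)
        (fun q => x.map (blockDiag hφ) p q (ξ q)) Finset.univ)
    · gcongr
      exact hi i
  · refine iSup_le fun i => ?_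
    rw [opMatNorm_le_opMatNorm_iff]
    have h1 : x.map (φ i) = (x.map (blockDiag hφ)).map fun T =>
        lp.evalCLM ℂ H 2 i ∘L T ∘L lp.singleContinuousLinearMap ℂ H 2 i := by
      ext p q ξ
      simp [lp.evalCLM, blockDiag_apply]
    rw [h1]
    refine (norm_amplify_conj_le _ _ _).trans ?_
    have h2 : ‖lp.evalCLM ℂ H 2 i‖ ≤ 1 := LinearMap.mkContinuous_norm_le _ zero_le_one _
    have h3 : ‖lp.singleContinuousLinearMap ℂ H 2 i‖ ≤ 1 :=
      ContinuousLinearMap.opNorm_le_bound _ zero_le_one fun ξ => by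
        simp [lp.norm_single]
    calc _ ≤ 1 * ‖amplify (x.map (blockDiag hφ))‖ * 1 := by gcongr
      _ = _ := by ring

lemma blockDiag_injective (hφ : IsBddSep φ) : Function.Injective (blockDiag hφ) := by
  classical
  refine (injective_iff_map_eq_zero _).2 fun v hv => hφ.sep v fun i => ?_
  ext ξ
  have h := congrArg (fun T : lp H 2 →L[ℂ] lp H 2 => T (lp.single 2 i ξ) i) hv
  simpa [blockDiag_apply] using h

/-- The range of a direct sum of operators is an operator space whose norms are the given ones. -/
lemma completelyIsometric_blockDiag (hφ : IsBddSep φ) :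
    CompletelyIsometric (supNorm φ) (subMatNorm (LinearMap.range (blockDiag hφ))) :=
  ⟨LinearEquiv.ofInjective _ (blockDiag_injective hφ), fun _ x => opMatNorm_blockDiag hφ x⟩

lemma IsBddSep.isOpNorm [FiniteDimensional ℂ V] (hφ : IsBddSep φ) : IsOpNorm (supNorm φ) :=
  (isOpNorm_subMatNorm _).of_completelyIsometric (completelyIsometric_blockDiag hφ)

end blockDiag

/-! ### Approximation of the norm at one level by finitely many operators -/

/-- On the compact unit sphere the open sets where `‖L i z‖ > c⁻¹` form a cover; a finite subcover
is extended by homogeneity. -/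
lemma exists_finset_norm_le {R : Type*} [NormedAddCommGroup R] [NormedSpace ℂ R]
    [FiniteDimensional ℂ R] {ι : Type*} {Y : ι → Type*} [∀ i, NormedAddCommGroup (Y i)]
    [∀ i, NormedSpace ℂ (Y i)] (L : ∀ i, R →ₗ[ℂ] Y i)
    (hL : ∀ z r, 0 < r → r < ‖z‖ → ∃ i, r < ‖L i z‖) {c : ℝ} (hc : 1 < c) :
    ∃ T : Finset ι, ∀ z, z ≠ 0 → ∃ i ∈ T, ‖z‖ ≤ c * ‖L i z‖ := by
  have : ProperSpace R := FiniteDimensional.proper ℂ R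
  obtain ⟨T, hT⟩ := (isCompact_sphere (0 : R) 1).elim_finite_subcover
    (fun i => {z | c⁻¹ < ‖L i z‖})
    (fun i => isOpen_lt continuous_const (L i).continuous_of_finiteDimensional.norm)
    (fun z hz => by
      obtain ⟨i, hi⟩ := hL z c⁻¹ (by positivity)
        (by rw [mem_sphere_zero_iff_norm.1 hz]; exact inv_lt_one_of_one_lt₀ hc)
      exact Set.mem_iUnion.2 ⟨i, hi⟩)
  refine ⟨T, fun z hz => ?_⟩
  have hz0 : 0 < ‖z‖ := norm_pos_iff.2 hz
  have h1 : ((‖z‖⁻¹ : ℝ) : ℂ) • z ∈ Metric.sphere (0 : R) 1 := by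
    rw [mem_sphere_zero_iff_norm, norm_smul, Complex.norm_real, norm_inv, norm_norm,
      inv_mul_cancel₀ hz0.ne']
  obtain ⟨i, hi, h2⟩ := Set.mem_iUnion₂.1 (hT h1)
  refine ⟨i, hi, ?_⟩
  simp only [Set.mem_ofPred_eq, map_smul, norm_smul, Complex.norm_real, norm_inv, norm_norm] at h2
  have hc0 : 0 < c := by linarith
  rw [inv_lt_iff_one_lt_mul₀ hc0, ← div_eq_inv_mul, div_mul_eq_mul_div, one_lt_div hz0] at h2
  rw [mul_comm]
  exact h2.le

section approx

variable {ι : Type*} {H : ι → Type*} [∀ i, NormedAddCommGroup (H i)]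
  [∀ i, InnerProductSpace ℂ (H i)] {V : Type*} [AddCommGroup V] [Module ℂ V]
  {φ : ∀ i, V →ₗ[ℂ] (H i →L[ℂ] H i)}

lemma supNorm_restrict_le (T : Finset ι) (k : ℕ) (x : Matrix (Fin k) (Fin k) V) :
    supNorm (fun i : T => φ i) k x ≤ supNorm φ k x :=
  iSup_le fun i => le_iSup (fun i => opMatNorm (H i) k (x.map (φ i))) (i : ι)

lemma IsBddSep.exists_finset [FiniteDimensional ℂ V] (hφ : IsBddSep φ) {k : ℕ} (hk : 1 ≤ k)
    {c : ℝ≥0} (hc : 1 < c) : ∃ T : Finset ι, IsBddSep (fun i : T => φ i) ∧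
      ∀ x : Matrix (Fin k) (Fin k) V, supNorm φ k x ≤ c * supNorm (fun i : T => φ i) k x := by
  -- `V` carries no topology; the range of `Ψ` provides a normed copy of `M_k(V)` on which the
  -- compactness argument runs.
  let Ψ : Matrix (Fin k) (Fin k) V →ₗ[ℂ] (HilbertPow (lp H 2) k →L[ℂ] HilbertPow (lp H 2) k) :=
    amplifyLM (lp H 2) k ∘ₗ (blockDiag hφ).mapMatrix
  have hΨ : ∀ x, ‖Ψ x‖ₑ = supNorm φ k x := opMatNorm_blockDiag hφ
  have hinj : Function.Injective Ψ := by
    refine (injective_iff_map_eq_zero _).2 fun x hx => (hφ.isOpNorm.lawful k x).2.1 ?_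
    have h0 : ‖Ψ x‖ = 0 := by rw [hx]; exact norm_zero
    rw [← hΨ, ← ofReal_norm, h0, ENNReal.ofReal_zero]
  let e := LinearEquiv.ofInjective Ψ hinj
  have he : ∀ x, ‖e x‖ₑ = supNorm φ k x := hΨ
  obtain ⟨T, hT⟩ := exists_finset_norm_le (R := LinearMap.range Ψ)
    (fun i => amplifyLM (H i) k ∘ₗ (φ i).mapMatrix ∘ₗ e.symm.toLinearMap) (fun z r hr0 hr => by
      have h1 : ENNReal.ofReal r < supNorm φ k (e.symm z) := by
        rw [← he, e.apply_symm_apply, ← ofReal_norm]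
        exact (ENNReal.ofReal_lt_ofReal_iff (hr0.trans hr)).2 hr
      obtain ⟨i, hi⟩ := lt_iSup_iff.1 h1
      refine ⟨i, ?_⟩
      rw [opMatNorm, ← ofReal_norm] at hi
      exact (ENNReal.ofReal_lt_ofReal_iff_of_nonneg hr0.le).1 hi) (c := c) (by exact_mod_cast hc)
  have key : ∀ x : Matrix (Fin k) (Fin k) V,
      supNorm φ k x ≤ c * supNorm (fun i : T => φ i) k x := by
    intro x
    by_cases hx : x = 0
    · refine le_of_eq_of_le ?_ zero_le
      simpa [hx] using (hφ.isOpNorm.lawful k 0).1 0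
    obtain ⟨i, hi, h⟩ := hT (e x) (by simpa using hx)
    simp only [LinearMap.comp_apply, LinearEquiv.coe_coe, LinearEquiv.symm_apply_apply,
      amplifyLM_apply, LinearMap.mapMatrix_apply] at h
    rw [← he]
    calc ‖e x‖ₑ ≤ c * opMatNorm (H i) k (x.map (φ i)) := by
          rw [opMatNorm, ← ofReal_norm, ← ofReal_norm, ← ENNReal.ofReal_coe_nnreal]
          exact (ENNReal.ofReal_le_ofReal h).trans_eq (ENNReal.ofReal_mul c.2)
      _ ≤ _ := by
          gcongr
          exact le_iSup (fun i : T => opMatNorm (H i) k (x.map (φ i))) ⟨i, hi⟩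
  refine ⟨T, ⟨fun v => ?_, fun v hv => ?_⟩, key⟩
  · obtain ⟨C, hC⟩ := hφ.bdd v
    exact ⟨C, fun i => hC i⟩
  · have h1 := key (Matrix.of fun _ _ => v)
    have h2 : supNorm (fun i : T => φ i) k (Matrix.of fun _ _ => v) = 0 := by
      refine ENNReal.iSup_eq_zero.2 fun i => ?_
      have : (Matrix.of fun _ _ => v : Matrix (Fin k) (Fin k) V).map (φ i) = 0 := by
        ext1 p q; exact hv i
      rw [this, opMatNorm_zero]
    rw [h2, mul_zero, nonpos_iff_eq_zero] at h1
    exact congrFun (congrFun ((hφ.isOpNorm.lawful k _).2.1 h1) ⟨0, hk⟩) ⟨0, hk⟩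

end approx

/-! ### The dual norms are operator space norms -/

section polar

variable {V : Type*} {W : Type*} [AddCommGroup V] [Module ℂ V] [AddCommGroup W] [Module ℂ W]

lemma IsLawful.exists_smul_le_one {μ : MatNorm V} (hμ : IsLawful μ) {k : ℕ}
    (x : Matrix (Fin k) (Fin k) V) : ∃ c : ℂ, c ≠ 0 ∧ μ k (c • x) ≤ 1 := by
  have htop := (hμ k x).2.2
  have hpos : 0 < (μ k x).toReal + 1 := by positivity
  refine ⟨(((μ k x).toReal + 1)⁻¹ : ℝ), by exact_mod_cast (inv_pos.2 hpos).ne', ?_⟩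
  rw [(hμ k x).1, ← ofReal_norm, Complex.norm_real, Real.norm_of_nonneg (by positivity),
    ← ENNReal.ofReal_toReal htop, ENNReal.toReal_ofReal ENNReal.toReal_nonneg,
    ← ENNReal.ofReal_mul (by positivity), ENNReal.ofReal_le_one, inv_mul_le_one₀ hpos]
  linarith

lemma norm_evalMap_le_pairNorm (B : V →ₗ[ℂ] W →ₗ[ℂ] ℂ) {m : ℕ} (x : Matrix (Fin m) (Fin m) V)
    {w : W} {C : ℝ≥0} (h : pairNorm B x (Matrix.of fun _ _ => w : Matrix (Fin 1) (Fin 1) W) ≤ C) :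
    ‖evalMap B x w‖ ≤ C := by
  rw [pairNorm, opMatNorm_le_iff] at h
  exact (norm_entry_le
    ((Matrix.of fun _ _ => w : Matrix (Fin 1) (Fin 1) W).map (evalMap B x)) 0 0).trans h

lemma pairNorm_one_le (B : V →ₗ[ℂ] W →ₗ[ℂ] ℂ) (x : Matrix (Fin 1) (Fin 1) V)
    (y : Matrix (Fin 1) (Fin 1) W) : pairNorm B x y ≤ ‖B (x 0 0) (y 0 0)‖₊ := by
  rw [pairNorm, opMatNorm_le_iff]
  refine norm_amplify_le (NNReal.coe_nonneg _) fun ξ => ?_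
  rw [sum_sq_evalMap]
  simp [EuclideanSpace.norm_sq_eq, mul_pow]

/-- A functional is completely bounded as soon as it is bounded: a `1 × 1` matrix over `W` is tested
at level one only. -/
lemma exists_norm_evalMap_le (B : V →ₗ[ℂ] W →ₗ[ℂ] ℂ) {μ : MatNorm V} (hμ : IsOpNorm μ) (w : W) :
    ∃ C : ℝ≥0, ∀ (m : ℕ) (x : Matrix (Fin m) (Fin m) V), μ m x ≤ 1 → ‖evalMap B x w‖ ≤ C := by
  obtain ⟨C, hC⟩ := hμ.bounded (B.flip w)
  refine ⟨C, fun m x hx => norm_evalMap_le_pairNorm B x ?_⟩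
  refine (pairNorm_le_polarNorm B hx _).trans (polarNorm_le_of_level B hμ fun x hx => ?_)
  exact (pairNorm_one_le B x _).trans ((hC 1 x 0 0).trans (mul_le_of_le_one_right' hx))

lemma eq_zero_of_evalMap {B : V →ₗ[ℂ] W →ₗ[ℂ] ℂ} (hB : B.SeparatingRight) {μ : MatNorm V}
    (hμ : IsOpNorm μ) {w : W}
    (hw : ∀ (m : ℕ) (x : Matrix (Fin m) (Fin m) V), μ m x ≤ 1 → evalMap B x w = 0) : w = 0 := by
  refine hB w fun v => ?_
  obtain ⟨c, hc0, hc⟩ := hμ.lawful.exists_smul_le_one (k := 1) (Matrix.of fun _ _ => v)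
  have h := hw 1 _ hc
  have h2 := evalMap_apply B (c • Matrix.of fun _ _ => v) w
    (EuclideanSpace.single (0 : Fin 1) (1 : ℂ)) 0
  rw [h] at h2
  simpa [hc0] using h2.symm

lemma isBddSep_evalMap (B : V →ₗ[ℂ] W →ₗ[ℂ] ℂ) (hB : B.SeparatingRight) {μ : MatNorm V}
    (hμ : IsOpNorm μ) : IsBddSep fun i : MatBall μ => evalMap B i.2.1 :=
  ⟨fun w => (exists_norm_evalMap_le B hμ w).imp fun _ hC i => hC i.1 i.2.1 i.2.2,
    fun _ hw => eq_zero_of_evalMap hB hμ fun m x hx => hw ⟨m, x, hx⟩⟩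

lemma isOpNorm_polarNorm [FiniteDimensional ℂ W] (B : V →ₗ[ℂ] W →ₗ[ℂ] ℂ)
    (hB : B.SeparatingRight) {μ : MatNorm V} (hμ : IsOpNorm μ) : IsOpNorm (polarNorm B μ) :=
  (isBddSep_evalMap B hB hμ).isOpNorm

end polar

/-! ### Compressions to finite-dimensional subspaces -/

section compress

variable {H : Type*} [NormedAddCommGroup H] [InnerProductSpace ℂ H]

/-- `S` is spanned by a finite `ε`-net of the image of the unit ball. -/
lemma exists_finiteDimensional_near_range {T : H →L[ℂ] H} (hT : IsCompactOperator T) {ε : ℝ}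
    (hε : 0 < ε) : ∃ S : Submodule ℂ H, FiniteDimensional ℂ S ∧
      ∀ ξ, ∃ s ∈ S, ‖T ξ - s‖ ≤ ε * ‖ξ‖ := by
  have h1 := (hT.isCompact_closure_image_closedBall 1).totallyBounded.subset subset_closure
  obtain ⟨t, ht, hcov⟩ := Metric.totallyBounded_iff.1 h1 ε hε
  refine ⟨Submodule.span ℂ t, FiniteDimensional.span_of_finite ℂ ht, fun ξ => ?_⟩
  by_cases hξ : ξ = 0
  · exact ⟨0, zero_mem _, by simp [hξ]⟩
  have hpos : 0 < ‖ξ‖ := norm_pos_iff.2 hξ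
  have h2 : T (((‖ξ‖⁻¹ : ℝ) : ℂ) • ξ) ∈ T '' Metric.closedBall 0 1 := by
    refine ⟨_, ?_, rfl⟩
    rw [mem_closedBall_zero_iff, norm_smul, Complex.norm_real, norm_inv, norm_norm,
      inv_mul_cancel₀ hpos.ne']
  obtain ⟨s, hs, h3⟩ := Set.mem_iUnion₂.1 (hcov h2)
  refine ⟨(‖ξ‖ : ℂ) • s, Submodule.smul_mem _ _ (Submodule.subset_span hs), ?_⟩
  rw [Metric.mem_ball, dist_eq_norm] at h3
  have h4 : T ξ - (‖ξ‖ : ℂ) • s = (‖ξ‖ : ℂ) • (T (((‖ξ‖⁻¹ : ℝ) : ℂ) • ξ) - s) := by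
    rw [map_smul, smul_sub, smul_smul, ← Complex.ofReal_mul, mul_inv_cancel₀ hpos.ne']
    simp
  rw [h4, norm_smul, Complex.norm_real, norm_norm, mul_comm]
  gcongr

lemma norm_le_of_mem_orthogonal {S : Submodule ℂ H} {z : H} (hz : z ∈ Sᗮ) {s : H} (hs : s ∈ S) :
    ‖z‖ ≤ ‖z - s‖ := by
  have h := norm_add_sq_eq_norm_sq_add_norm_sq_of_inner_eq_zero (𝕜 := ℂ) z (-s) (by
    rw [inner_neg_right, Submodule.inner_left_of_mem_orthogonal hs hz, neg_zero])
  rw [← sub_eq_add_neg] at h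
  nlinarith [norm_nonneg z, norm_nonneg (z - s), norm_nonneg (-s)]

variable [CompleteSpace H]

lemma exists_isometry_starProjection (S : Submodule ℂ H) [FiniteDimensional ℂ S] :
    ∃ (N : ℕ) (J : EuclideanSpace ℂ (Fin N) →L[ℂ] H), ‖J‖ ≤ 1 ∧ ‖J.adjoint‖ ≤ 1 ∧
      J ∘L J.adjoint = S.starProjection := by
  let b := stdOrthonormalBasis ℂ S
  let J : EuclideanSpace ℂ (Fin (Module.finrank ℂ S)) →L[ℂ] H :=
    S.subtypeL ∘L (b.repr.symm : EuclideanSpace ℂ (Fin (Module.finrank ℂ S)) →L[ℂ] S)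
  have h1 : ‖J‖ ≤ 1 := ContinuousLinearMap.opNorm_le_bound _ zero_le_one fun ξ => by
    rw [one_mul]
    exact (b.repr.symm.norm_map ξ).le
  refine ⟨_, J, h1, by rwa [LinearIsometryEquiv.norm_map], ?_⟩
  have h2 : J.adjoint = (b.repr : S →L[ℂ] EuclideanSpace ℂ (Fin (Module.finrank ℂ S))) ∘L
      S.orthogonalProjectionOnto := by
    rw [ContinuousLinearMap.adjoint_comp, Submodule.adjoint_subtypeL]
    congr 1
    exact LinearIsometryEquiv.adjoint_eq_symm b.repr.symm
  ext ξ
  rw [h2]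
  simp [J]

/-- The compression `T ↦ J* T J`. -/
def compress {K : Type*} [NormedAddCommGroup K] [InnerProductSpace ℂ K] [CompleteSpace K]
    (J : K →L[ℂ] H) : (H →L[ℂ] H) →ₗ[ℂ] (K →L[ℂ] K) where
  toFun T := J.adjoint ∘L T ∘L J
  map_add' S T := by ext; simp
  map_smul' c T := by ext; simp

@[simp]
lemma compress_apply {K : Type*} [NormedAddCommGroup K] [InnerProductSpace ℂ K] [CompleteSpace K]
    (J : K →L[ℂ] H) (T : H →L[ℂ] H) : compress J T = J.adjoint ∘L T ∘L J := rfl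

lemma norm_amplify_compress_le {K : Type*} [NormedAddCommGroup K] [InnerProductSpace ℂ K]
    [CompleteSpace K] {J : K →L[ℂ] H} (hJ : ‖J‖ ≤ 1) {k : ℕ}
    (x : Matrix (Fin k) (Fin k) (H →L[ℂ] H)) : ‖amplify (x.map (compress J))‖ ≤ ‖amplify x‖ := by
  refine (norm_amplify_conj_le J.adjoint J x).trans ?_
  have : ‖J.adjoint‖ ≤ 1 := by rwa [LinearIsometryEquiv.norm_map]
  calc _ ≤ 1 * ‖amplify x‖ * 1 := by gcongr
    _ = _ := by ring

lemma norm_amplify_proj_le {K : Type*} [NormedAddCommGroup K] [InnerProductSpace ℂ K]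
    [CompleteSpace K] {J : K →L[ℂ] H} (hJ : ‖J‖ ≤ 1) {k : ℕ}
    (x : Matrix (Fin k) (Fin k) (H →L[ℂ] H)) :
    ‖amplify (x.map fun T => (J ∘L J.adjoint) ∘L T ∘L (J ∘L J.adjoint))‖ ≤
      ‖amplify (x.map (compress J))‖ := by
  have h := norm_amplify_conj_le J J.adjoint (x.map (compress J))
  have : ‖J.adjoint‖ ≤ 1 := by rwa [LinearIsometryEquiv.norm_map]
  refine h.trans ?_
  calc _ ≤ 1 * ‖amplify (x.map (compress J))‖ * 1 := by gcongr
    _ = _ := by ring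

/-- For given test vectors, a projection fixing these vectors and their images under `x` does not
alter the inequality to be proved. -/
lemma norm_amplify_le_of_compress {k : ℕ} (x : Matrix (Fin k) (Fin k) (H →L[ℂ] H)) {C : ℝ}
    (hC : 0 ≤ C) (h : ∀ (N : ℕ) (J : EuclideanSpace ℂ (Fin N) →L[ℂ] H), ‖J‖ ≤ 1 →
      ‖amplify (x.map (compress J))‖ ≤ C) : ‖amplify x‖ ≤ C := by
  refine norm_amplify_le hC fun ξ => ?_
  let η : Fin k ⊕ Fin k → H := Sum.elim ξ fun i => ∑ j, x i j (ξ j)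
  let S := Submodule.span ℂ (Set.range η)
  have : FiniteDimensional ℂ S := FiniteDimensional.span_of_finite ℂ (Set.finite_range η)
  have hS : ∀ s, S.starProjection (η s) = η s := fun s =>
    Submodule.starProjection_eq_self_iff.2 (Submodule.subset_span ⟨s, rfl⟩)
  obtain ⟨N, J, hJ, _, hJS⟩ := exists_isometry_starProjection S
  have h1 := sum_sq_amplify_le (x.map fun T => (J ∘L J.adjoint) ∘L T ∘L (J ∘L J.adjoint)) ξ
  have h2 : ∀ i, ∑ j, (x.map fun T => (J ∘L J.adjoint) ∘L T ∘L (J ∘L J.adjoint)) i j (ξ j) =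
      ∑ j, x i j (ξ j) := by
    intro i
    have h3 : ∀ j, S.starProjection (ξ j) = ξ j := fun j => hS (Sum.inl j)
    simp only [hJS, Matrix.map_apply, ContinuousLinearMap.comp_apply, h3]
    rw [← map_sum]
    exact hS (Sum.inr i)
  simp_rw [h2] at h1
  refine h1.trans ?_
  gcongr
  exact (norm_amplify_proj_le hJ x).trans (h N J hJ)

/-! ### Compact operators -/

lemma exists_compress_near {ι : Type*} [Finite ι] (f : ι → H →L[ℂ] H)
    (hf : ∀ i, IsCompactOperator (f i)) {ε : ℝ} (hε : 0 < ε) :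
    ∃ S : Submodule ℂ H, ∃ _ : FiniteDimensional ℂ S,
      ∀ i, ‖f i - S.starProjection ∘L f i ∘L S.starProjection‖ ≤ ε := by
  choose S hSfin hS using fun i => exists_finiteDimensional_near_range (hf i) (half_pos hε)
  let S₁ : Submodule ℂ H := ⨆ i, S i
  have : FiniteDimensional ℂ S₁ := inferInstance
  -- With the adjoint images included, `f i` sends vectors orthogonal to `S₂` to vectors orthogonal
  -- to `S₁`. Such images are also close to `S₁`, hence small.
  let S₂ : Submodule ℂ H := S₁ ⊔ ⨆ i, S₁.map ((f i).adjoint : H →ₗ[ℂ] H)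
  have hfin : FiniteDimensional ℂ S₂ := inferInstance
  refine ⟨S₂, hfin, fun i => ContinuousLinearMap.opNorm_le_bound _ hε.le fun ξ => ?_⟩
  have h12 : S₁ ≤ S₂ := le_sup_left
  have hS₁ : S i ≤ S₁ := le_iSup S i
  set P := S₂.starProjection with hP
  have horth : ∀ z, z - P z ∈ S₂ᗮ := fun z => S₂.sub_starProjection_mem_orthogonal z
  have hnorm : ∀ z, ‖z - P z‖ ≤ ‖z‖ := fun z => by
    have h := norm_le_of_mem_orthogonal (horth z) (s := -(P z))
      (neg_mem (S₂.starProjection_apply_mem z))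
    simpa using h
  have h1 : ‖f i ξ - P (f i ξ)‖ ≤ ε / 2 * ‖ξ‖ := by
    obtain ⟨s, hs, hle⟩ := hS i ξ
    refine le_trans ?_ hle
    have h := norm_le_of_mem_orthogonal (horth (f i ξ)) (s := s - P (f i ξ))
      (sub_mem (h12 (hS₁ hs)) (S₂.starProjection_apply_mem _))
    simpa using h
  have h2 : ‖f i (ξ - P ξ)‖ ≤ ε / 2 * ‖ξ‖ := by
    obtain ⟨s, hs, hle⟩ := hS i (ξ - P ξ)
    have hmem : f i (ξ - P ξ) ∈ S₁ᗮ := by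
      rw [Submodule.mem_orthogonal]
      intro s hs
      rw [← ContinuousLinearMap.adjoint_inner_left]
      refine Submodule.inner_right_of_mem_orthogonal (K := S₂) ?_ (horth ξ)
      exact le_sup_right (a := S₁) (Submodule.mem_iSup_of_mem i (Submodule.mem_map_of_mem hs))
    exact (norm_le_of_mem_orthogonal hmem (hS₁ hs)).trans
      (hle.trans (by gcongr; exact hnorm ξ))
  have h3 : (f i - P ∘L f i ∘L P) ξ = (f i ξ - P (f i ξ)) + P (f i (ξ - P ξ)) := by
    simp
  rw [h3]
  calc _ ≤ ‖f i ξ - P (f i ξ)‖ + ‖P (f i (ξ - P ξ))‖ := norm_add_le _ _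
    _ ≤ ε / 2 * ‖ξ‖ + ε / 2 * ‖ξ‖ :=
        add_le_add h1 ((S₂.norm_starProjection_apply_le _).trans h2)
    _ = _ := by ring

end compress

/-! ### The bidual -/

section bidual

variable {V : Type*} [AddCommGroup V] [Module ℂ V]

variable (V) in
/-- The pairing of a space with its dual. -/
abbrev dualPair : V →ₗ[ℂ] Module.Dual ℂ V →ₗ[ℂ] ℂ := Module.Dual.eval ℂ V

lemma separatingRight_dualPair : (dualPair V).SeparatingRight :=
  fun _ h => LinearMap.ext h

lemma separatingLeft_dualPair : (dualPair V).SeparatingLeft :=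
  fun v h => (Module.forall_dual_apply_eq_zero_iff ℂ v).1 h

lemma exists_pairNorm_eq {N : ℕ}
    (c : V →ₗ[ℂ] (EuclideanSpace ℂ (Fin N) →L[ℂ] EuclideanSpace ℂ (Fin N))) :
    ∃ y : Matrix (Fin N) (Fin N) (Module.Dual ℂ V), ∀ (k : ℕ) (x : Matrix (Fin k) (Fin k) V),
      pairNorm (dualPair V) x y = opMatNorm (EuclideanSpace ℂ (Fin N)) k (x.map c) := by
  let y : Matrix (Fin N) (Fin N) (Module.Dual ℂ V) := Matrix.of fun i j =>
    { toFun := fun v => c v (EuclideanSpace.single j 1) i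
      map_add' := by simp
      map_smul' := by simp }
  have hy : evalMap (dualPair V).flip y = c := by
    ext v ξ i
    rw [evalMap_apply]
    have h : ξ = ∑ j, ξ j • EuclideanSpace.single j (1 : ℂ) := by
      ext i; simp [Pi.single_apply]
    conv_rhs => rw [h]
    simp [y, mul_comm]
  refine ⟨y, fun k x => ?_⟩
  rw [← pairNorm_flip, pairNorm, hy]

variable {H : Type*} [NormedAddCommGroup H] [InnerProductSpace ℂ H] [CompleteSpace H]

/-- Compressions to finite-dimensional spaces determine the norm, and each of them is a complete
contraction into some `M_N`, that is, an element of the unit ball of `M_N(E*)`. -/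
lemma polarNorm_polarNorm_subMatNorm (E : Submodule ℂ (H →L[ℂ] H)) {k : ℕ}
    (x : Matrix (Fin k) (Fin k) E) :
    polarNorm (dualPair E).flip (polarNorm (dualPair E) (subMatNorm E)) k x =
      subMatNorm E k x := by
  refine le_antisymm (polarNorm_polarNorm_le _ (isLawful_subMatNorm E) x) ?_
  generalize hC : polarNorm (dualPair E).flip (polarNorm (dualPair E) (subMatNorm E)) k x = C
  induction C using ENNReal.recTopCoe with
  | top => exact le_top
  | coe C =>
  rw [subMatNorm, opMatNorm_le_iff]
  refine norm_amplify_le_of_compress _ C.2 fun N J hJ => ?_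
  obtain ⟨y, hy⟩ := exists_pairNorm_eq (compress J ∘ₗ E.subtype)
  have h1 : polarNorm (dualPair E) (subMatNorm E) N y ≤ 1 := by
    refine polarNorm_le _ fun m z hz => ?_
    rw [hy]
    refine le_trans ?_ hz
    rw [subMatNorm, opMatNorm_le_opMatNorm_iff]
    exact norm_amplify_compress_le hJ (z.map E.subtype)
  have h2 := pairNorm_le_polarNorm (dualPair E).flip h1 x
  rw [pairNorm_flip, hy, hC, opMatNorm_le_iff] at h2
  exact h2

end bidual

/-! ### Maps into spaces of compact operators -/

section compact

variable {V : Type*} [AddCommGroup V] [Module ℂ V] [FiniteDimensional ℂ V]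

lemma opMatNorm_sum_le {H : Type*} [NormedAddCommGroup H] [InnerProductSpace ℂ H] {k : ℕ}
    {ι : Type*} (s : Finset ι) (f : ι → Matrix (Fin k) (Fin k) (H →L[ℂ] H)) :
    opMatNorm H k (∑ i ∈ s, f i) ≤ ∑ i ∈ s, opMatNorm H k (f i) := by
  have h : amplify (∑ i ∈ s, f i) = ∑ i ∈ s, amplify (f i) := map_sum (amplifyLM H k) f s
  rw [opMatNorm, h]
  exact enorm_sum_le s fun i => amplify (f i)

lemma exists_opMatNorm_smulRight_le {μ : MatNorm V} (hμ : IsOpNorm μ) (φ : V →ₗ[ℂ] ℂ) :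
    ∃ C : ℝ≥0, ∀ {H : Type v} [NormedAddCommGroup H] [InnerProductSpace ℂ H] (D : H →L[ℂ] H)
      (k : ℕ) (x : Matrix (Fin k) (Fin k) V),
      opMatNorm H k (x.map (φ.smulRight D)) ≤ (C * ‖D‖₊ : ℝ≥0) * μ k x := by
  let y : Matrix (Fin 1) (Fin 1) (Module.Dual ℂ V) := Matrix.of fun _ _ => φ
  have htop := ((isOpNorm_polarNorm (dualPair V) separatingRight_dualPair hμ).lawful 1 y).2.2
  obtain ⟨C, hC⟩ : ∃ C : ℝ≥0, (C : ℝ≥0∞) = _ := ⟨_, ENNReal.coe_toNNReal htop⟩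
  refine ⟨C, fun {H} _ _ D k x => ?_⟩
  obtain ⟨M, hM⟩ : ∃ M : ℝ≥0, (M : ℝ≥0∞) = _ :=
    ⟨_, ENNReal.coe_toNNReal (hμ.lawful k x).2.2⟩
  have h1 := pairNorm_le_mul (dualPair V) hμ.lawful x y
  rw [← hC, ← hM, ← pairNorm_flip, pairNorm, ← ENNReal.coe_mul, opMatNorm_le_iff] at h1
  rw [← hM, ← ENNReal.coe_mul, opMatNorm_le_iff]
  have h2 : ∀ ξ : Fin k → ℂ, ∑ i, ‖∑ j, φ (x i j) * ξ j‖ ^ 2 ≤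
      (C * M : ℝ≥0) ^ 2 * ∑ j, ‖ξ j‖ ^ 2 := by
    intro ξ
    have h3 := sum_sq_amplify_le (x.map (evalMap (dualPair V).flip y))
      fun j => WithLp.toLp 2 fun _ => ξ j
    rw [sum_sq_evalMap] at h3
    simp only [EuclideanSpace.norm_sq_eq, Finset.univ_unique, Finset.sum_singleton] at h3
    exact h3.trans (by gcongr)
  refine norm_amplify_le (NNReal.coe_nonneg _) fun ξ => ?_
  refine (sum_sq_smul_le (a := Matrix.of fun i j => φ (x i j)) h2 fun j => D (ξ j)).trans ?_
  calc ((C * M : ℝ≥0) : ℝ) ^ 2 * ∑ j, ‖D (ξ j)‖ ^ 2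
      ≤ ((C * M : ℝ≥0) : ℝ) ^ 2 * ∑ j, ‖D‖ ^ 2 * ‖ξ j‖ ^ 2 := by
        gcongr with j
        rw [← mul_pow]
        gcongr
        exact D.le_opNorm _
    _ = _ := by
        rw [← Finset.mul_sum]
        push_cast
        ring

/-- A map that is small on a basis is a sum of coordinate functionals times small operators. The
constant depends neither on the map, nor on the Hilbert space, nor on the level, so it serves for cb
perturbation. -/
lemma exists_opMatNorm_map_le {μ : MatNorm V} (hμ : IsOpNorm μ) {ι : Type*} [Fintype ι]
    (b : Module.Basis ι ℂ V) :
    ∃ C : ℝ≥0, ∀ {H : Type v} [NormedAddCommGroup H] [InnerProductSpace ℂ H]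
      (u : V →ₗ[ℂ] (H →L[ℂ] H)) (ε : ℝ≥0), (∀ i, ‖u (b i)‖₊ ≤ ε) →
      ∀ (k : ℕ) (x : Matrix (Fin k) (Fin k) V),
        opMatNorm H k (x.map u) ≤ (C * ε : ℝ≥0) * μ k x := by
  choose C hC using fun i => exists_opMatNorm_smulRight_le.{v} hμ (b.coord i)
  refine ⟨∑ i, C i, fun {H} _ _ u ε hu k x => ?_⟩
  have h1 : x.map u = ∑ i, x.map ((b.coord i).smulRight (u (b i))) := by
    ext1 p q
    rw [Matrix.sum_apply]
    conv_lhs => rw [Matrix.map_apply, ← b.sum_repr (x p q), map_sum]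
    simp
  rw [h1]
  refine (opMatNorm_sum_le _ _).trans ?_
  rw [Finset.sum_mul, ENNReal.ofNNReal_finsetSum, Finset.sum_mul]
  refine Finset.sum_le_sum fun i _ => (hC i (u (b i)) k x).trans ?_
  gcongr
  exact hu i

/-- The map `T ↦ P T P`. -/
def cutoff {H : Type*} [NormedAddCommGroup H] [InnerProductSpace ℂ H] (P : H →L[ℂ] H) :
    (H →L[ℂ] H) →ₗ[ℂ] (H →L[ℂ] H) where
  toFun T := P ∘L T ∘L P
  map_add' S T := by ext; simp
  map_smul' c T := by ext; simp

lemma exists_compress_of_isCompactOperator {H : Type v} [NormedAddCommGroup H]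
    [InnerProductSpace ℂ H] [CompleteSpace H] (F : Submodule ℂ (H →L[ℂ] H))
    [FiniteDimensional ℂ F] (hF : ∀ T ∈ F, IsCompactOperator T) {c : ℝ≥0} (hc : 1 < c) :
    ∃ (N : ℕ) (J : EuclideanSpace ℂ (Fin N) →L[ℂ] H), ‖J‖ ≤ 1 ∧
      ∀ (k : ℕ) (x : Matrix (Fin k) (Fin k) F), subMatNorm F k x ≤
        c * opMatNorm (EuclideanSpace ℂ (Fin N)) k (x.map (compress J ∘ₗ F.subtype)) := by
  let b := Module.finBasis ℂ F
  obtain ⟨C, hC⟩ := exists_opMatNorm_map_le.{v} (isOpNorm_subMatNorm F) b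
  have hc0 : (0 : ℝ) < c := lt_trans zero_lt_one (by exact_mod_cast hc)
  have hδ : (0 : ℝ) < 1 - (c : ℝ)⁻¹ := sub_pos.2 (inv_lt_one_of_one_lt₀ (by exact_mod_cast hc))
  -- This makes `C * ε ≤ 1 - c⁻¹`, so the cutoff error is absorbed in `‖x‖ ≤ (1 - c⁻¹) ‖x‖ + ‖P x
  -- P‖`.
  let ε : ℝ := (1 - (c : ℝ)⁻¹) / (C + 1)
  have hε : 0 < ε := div_pos hδ (by positivity)
  obtain ⟨S, hS, hnear⟩ := exists_compress_near (fun i => (b i : H →L[ℂ] H))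
    (fun i => hF _ (b i).2) hε
  obtain ⟨N, J, hJ, _, hJS⟩ := exists_isometry_starProjection S
  refine ⟨N, J, hJ, fun k x => ?_⟩
  have h1 := hC (F.subtype - cutoff (J ∘L J.adjoint) ∘ₗ F.subtype) ⟨ε, hε.le⟩ (fun i => by
    rw [hJS]; exact hnear i) k x
  have h2 : ‖amplify (x.map (F.subtype - cutoff (J ∘L J.adjoint) ∘ₗ F.subtype))‖ ≤
      C * ε * ‖amplify (x.map F.subtype)‖ := by
    have h3 : ((C * ⟨ε, hε.le⟩ : ℝ≥0) : ℝ≥0∞) * subMatNorm F k x =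
        ((C * ⟨ε, hε.le⟩ * ‖amplify (x.map F.subtype)‖₊ : ℝ≥0) : ℝ≥0∞) := by
      rw [ENNReal.coe_mul _ ‖amplify (x.map F.subtype)‖₊]; rfl
    rw [h3, opMatNorm_le_iff] at h1
    exact h1
  have h4 : amplify (x.map F.subtype) =
      amplify (x.map (F.subtype - cutoff (J ∘L J.adjoint) ∘ₗ F.subtype)) +
        amplify ((x.map F.subtype).map
          fun T => (J ∘L J.adjoint) ∘L T ∘L (J ∘L J.adjoint)) := by
    rw [← amplify_add]
    congr 1
    ext1 p q
    simp [cutoff]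
  have h5 : C * ε ≤ 1 - (c : ℝ)⁻¹ := by
    rw [show (C : ℝ) * ε = (1 - (c : ℝ)⁻¹) * (C / (C + 1)) by simp only [ε]; ring]
    refine mul_le_of_le_one_right hδ.le ((div_le_one (by positivity)).2 (by linarith))
  have h6 := norm_amplify_proj_le hJ (x.map F.subtype)
  have h7 : ‖amplify (x.map F.subtype)‖ ≤
      (1 - (c : ℝ)⁻¹) * ‖amplify (x.map F.subtype)‖ +
        ‖amplify ((x.map F.subtype).map (compress J))‖ := by
    conv_lhs => rw [h4]
    refine (norm_add_le _ _).trans (add_le_add (h2.trans ?_) h6)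
    gcongr
  have h8 : ‖amplify (x.map F.subtype)‖ ≤ c * ‖amplify ((x.map F.subtype).map (compress J))‖ := by
    have : (c : ℝ)⁻¹ * ‖amplify (x.map F.subtype)‖ ≤
        ‖amplify ((x.map F.subtype).map (compress J))‖ := by linarith
    rwa [inv_mul_le_iff₀ hc0] at this
  have h9 : (c : ℝ≥0∞) * opMatNorm (EuclideanSpace ℂ (Fin N)) k
      (x.map (compress J ∘ₗ F.subtype)) =
      ((c * ‖amplify ((x.map F.subtype).map (compress J))‖₊ : ℝ≥0) : ℝ≥0∞) := by
    rw [ENNReal.coe_mul]; rfl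
  rw [h9, subMatNorm, opMatNorm_le_iff]
  exact h8

/-- If `d_SK(V) ≤ 1` then the completely bounded norm of maps into `V` is nearly attained at a
fixed level. -/
lemma exists_cbNorm_le_levelNorm {μ : MatNorm V} (hμ : IsOpNorm μ) (h : dSK μ ≤ 1) {c : ℝ≥0}
    (hc : 1 < c) :
    ∃ N : ℕ, ∀ {W : Type w} [AddCommGroup W] [Module ℂ W] (ν : MatNorm W), IsOpNorm ν →
      ∀ u : W →ₗ[ℂ] V, cbNorm ν μ u ≤ c * c * levelNorm ν μ N u := by
  have h1 : dSK μ < c := h.trans_lt (by exact_mod_cast hc)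
  simp only [dSK, dCb, iInf_lt_iff] at h1
  obtain ⟨F, -, hFK, e, he⟩ := h1
  have : FiniteDimensional ℂ F := e.finiteDimensional
  obtain ⟨N, J, hJ, hN⟩ := exists_compress_of_isCompactOperator F hFK hc
  refine ⟨N, fun {W} _ _ ν hν u => cbNorm_le_of_forall fun k x => ?_⟩
  have hF := isOpNorm_subMatNorm F
  set g : W →ₗ[ℂ] _ := (compress J ∘ₗ F.subtype) ∘ₗ e.toLinearMap ∘ₗ u
  -- The map `g` into `M_N` is an `N × N` matrix over the dual of `W`, so its size at every level is
  -- controlled at level `N`. One factor `c` pays for `e`, the other for the compression.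
  obtain ⟨y, hy⟩ := exists_pairNorm_eq g
  have hg : ∀ {m : ℕ} (z : Matrix (Fin m) (Fin m) W),
      z.map g = ((z.map u).map e.toLinearMap).map (compress J ∘ₗ F.subtype) := fun z => rfl
  have h2 : polarNorm (dualPair W) ν N y ≤ cbNorm μ (subMatNorm F) e.toLinearMap *
      levelNorm ν μ N u := by
    refine polarNorm_le_of_level _ hν fun z hz => ?_
    rw [hy, hg]
    have h3 : opMatNorm (EuclideanSpace ℂ (Fin N)) N
        (((z.map u).map e.toLinearMap).map (compress J ∘ₗ F.subtype)) ≤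
        subMatNorm F N ((z.map u).map e.toLinearMap) := by
      rw [subMatNorm, opMatNorm_le_opMatNorm_iff]
      exact norm_amplify_compress_le hJ (((z.map u).map e.toLinearMap).map F.subtype)
    refine h3.trans ((le_cbNorm_mul hμ hF e.toLinearMap _).trans (mul_le_mul' le_rfl ?_))
    exact le_iSup₂_of_le z hz le_rfl
  have h4 : x.map u = ((x.map u).map e.toLinearMap).map e.symm.toLinearMap := by
    ext1 p q; simp
  calc μ k (x.map u)
      ≤ cbNorm (subMatNorm F) μ e.symm.toLinearMap *
          subMatNorm F k ((x.map u).map e.toLinearMap) := by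
        conv_lhs => rw [h4]
        exact le_cbNorm_mul hF hμ _ _
    _ ≤ cbNorm (subMatNorm F) μ e.symm.toLinearMap * (c * ((cbNorm μ (subMatNorm F) e.toLinearMap *
          levelNorm ν μ N u) * ν k x)) := by
        gcongr
        refine (hN k _).trans ?_
        gcongr
        rw [← hg, ← hy]
        exact (pairNorm_le_mul _ hν.lawful x y).trans (by gcongr)
    _ = (cbNorm μ (subMatNorm F) e.toLinearMap * cbNorm (subMatNorm F) μ e.symm.toLinearMap) *
          c * levelNorm ν μ N u * ν k x := by ring
    _ ≤ _ := by gcongr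

end compact

/-! ### The operator space dual -/

lemma completelyIsometric_dualMatNorm {H : Type*} [NormedAddCommGroup H] [InnerProductSpace ℂ H]
    (E : Submodule ℂ (H →L[ℂ] H)) [FiniteDimensional ℂ E] :
    CompletelyIsometric (dualMatNorm E) (polarNorm (dualPair E) (subMatNorm E)) := by
  let e : StrongDual ℂ E ≃ₗ[ℂ] Module.Dual ℂ E := LinearMap.toContinuousLinearMap.symm
  refine ⟨e, fun k φ => ?_⟩
  have h : ∀ (m : ℕ) (x : Matrix (Fin m) (Fin m) E), pairNorm (dualPair E) x (φ.map e) =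
      opMatNorm (EuclideanSpace ℂ (Fin k)) m (x.map (dualMatrixMap E φ)) := by
    intro m x
    rw [← pairNorm_flip]
    rfl
  apply le_antisymm
  · refine polarNorm_le _ fun m x hx => ?_
    rw [h]
    -- The dual norm also ranges over matrices of size zero, which contribute nothing.
    rcases Nat.eq_zero_or_pos m with rfl | hm
    · have h0 : x.map (dualMatrixMap E φ) = 0 := Subsingleton.elim _ _
      rw [h0, opMatNorm_zero]
      exact zero_le
    · refine le_iSup₂_of_le m hm ?_
      exact le_iSup₂_of_le x hx le_rfl
  · refine iSup₂_le fun m _ => iSup₂_le fun x hx => ?_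
    rw [← h]
    exact pairNorm_le_polarNorm _ hx _

/-! ### Distances and complete isometries -/

section dist

variable {V : Type*} {W : Type*} {X : Type*} [AddCommGroup V] [Module ℂ V] [AddCommGroup W]
  [Module ℂ W] [AddCommGroup X] [Module ℂ X] {μ : MatNorm V} {ν : MatNorm W} {ρ : MatNorm X}

lemma dLevel_le_of_completelyIsometric (hμ : IsLawful μ) (hν : IsLawful ν) (hρ : IsLawful ρ)
    (h : CompletelyIsometric ν ρ) (k : ℕ) : dLevel μ ρ k ≤ dLevel μ ν k := by
  obtain ⟨e, he⟩ := h
  refine le_iInf fun u => iInf_le_of_le (u.trans e) ?_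
  have h1 := levelNorm_comp_le (μ := μ) hν hρ k u.toLinearMap e.toLinearMap
  have h2 := levelNorm_comp_le (μ := ρ) hν hμ k e.symm.toLinearMap u.symm.toLinearMap
  have h3 := CompletelyIsometric.levelNorm_le he k
  exact mul_le_mul' (h1.trans (mul_le_of_le_one_left' h3.1))
    (h2.trans (mul_le_of_le_one_right' h3.2))

lemma dCb_le_of_completelyIsometric (hμ : IsLawful μ) (hν : IsLawful ν) (hρ : IsLawful ρ)
    (h : CompletelyIsometric ν ρ) : dCb μ ρ ≤ dCb μ ν := by
  obtain ⟨e, he⟩ := h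
  refine le_iInf fun u => iInf_le_of_le (u.trans e) ?_
  have h1 := cbNorm_comp_le (μ := μ) hν hρ u.toLinearMap e.toLinearMap
  have h2 := cbNorm_comp_le (μ := ρ) hν hμ e.symm.toLinearMap u.symm.toLinearMap
  exact mul_le_mul'
    (h1.trans (mul_le_of_le_one_left'
      (iSup₂_le fun k _ => (CompletelyIsometric.levelNorm_le he k).1)))
    (h2.trans (mul_le_of_le_one_right'
      (iSup₂_le fun k _ => (CompletelyIsometric.levelNorm_le he k).2)))

lemma dSK_le_of_completelyIsometric (hμ : IsLawful μ) (hν : IsLawful ν)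
    (h : CompletelyIsometric μ ν) : dSK ν ≤ dSK μ := by
  refine le_iInf fun F => le_iInf₂ fun hF hFK => iInf_le_of_le F (iInf₂_le_of_le hF hFK ?_)
  rw [dCb_comm, dCb_comm μ]
  exact dCb_le_of_completelyIsometric (isLawful_subMatNorm F) hμ hν h

/-- The identity of a nonzero space has norm at least one at level one, and it factors through `u`.
-/
lemma one_le_dCb [Nontrivial V] (hμ : IsLawful μ) (hν : IsLawful ν) : 1 ≤ dCb μ ν := by
  refine le_iInf fun u => ?_
  obtain ⟨v, hv⟩ := exists_ne (0 : V)
  let x : Matrix (Fin 1) (Fin 1) V := Matrix.of fun _ _ => v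
  have hx : μ 1 x ≠ 0 := fun h => hv (congrFun (congrFun ((hμ 1 x).2.1 h) 0) 0)
  have h1 := le_levelNorm_mul hμ hμ (LinearMap.id : V →ₗ[ℂ] V) x
  have h2 : x.map (LinearMap.id : V →ₗ[ℂ] V) = x := by ext; rfl
  rw [h2] at h1
  have h3 : 1 ≤ levelNorm μ μ 1 (LinearMap.id : V →ₗ[ℂ] V) := by
    by_contra! hlt
    exact absurd h1 (not_le.2 (ENNReal.mul_lt_of_lt_div (by
      rwa [ENNReal.div_self hx (hμ 1 x).2.2])))
  have h4 := levelNorm_comp_le (μ := μ) hν hμ 1 u.toLinearMap u.symm.toLinearMap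
  rw [u.symm_comp] at h4
  refine h3.trans (h4.trans ?_)
  rw [mul_comm]
  exact mul_le_mul' (le_iSup₂_of_le 1 le_rfl le_rfl) (le_iSup₂_of_le 1 le_rfl le_rfl)

lemma one_le_dSK [Nontrivial V] (hμ : IsLawful μ) : 1 ≤ dSK μ :=
  le_iInf fun F => le_iInf₂ fun _ _ => one_le_dCb hμ (isLawful_subMatNorm F)

lemma dCb_polarNorm_le (hμ : IsOpNorm μ) (hν : IsOpNorm ν) :
    dCb (polarNorm (dualPair V) μ) (polarNorm (dualPair W) ν) ≤ dCb μ ν := by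
  refine le_iInf fun u => iInf_le_of_le u.symm.dualMap ?_
  rw [mul_comm (cbNorm μ ν _)]
  exact mul_le_mul' (cbNorm_adjoint_le (fun _ _ => rfl) hν hμ)
    (cbNorm_adjoint_le (fun _ _ => rfl) hμ hν)

end dist

/-! ### Operators on finite-dimensional spaces as compact operators -/

lemma exists_isometry_ell2 (K : Type*) [NormedAddCommGroup K] [InnerProductSpace ℂ K]
    [FiniteDimensional ℂ K] : Nonempty (K →ₗᵢ[ℂ] Ell2) := by
  have h : Orthonormal ℂ (HilbertBasis.ofRepr (LinearIsometryEquiv.refl ℂ Ell2)) :=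
    HilbertBasis.orthonormal _
  let b := stdOrthonormalBasis ℂ K
  have h2 := h.comp (fun i : Fin (Module.finrank ℂ K) => (i : ℕ)) Fin.val_injective
  refine ⟨(b.toBasis.constr ℂ (fun i => HilbertBasis.ofRepr (LinearIsometryEquiv.refl ℂ Ell2)
    (i : ℕ))).isometryOfOrthonormal (v := b.toBasis) (by simp) ?_⟩
  convert h2 using 1
  ext1 i
  simp only [Function.comp_apply, Module.Basis.constr_basis]

/-- For an isometry `J : K → ℓ₂`, the map `T ↦ J T J*` is a complete contraction with the completely
contractive left inverse `compress J`. -/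
lemma exists_compact_of_finiteDimensional {K : Type*} [NormedAddCommGroup K]
    [InnerProductSpace ℂ K] [FiniteDimensional ℂ K] (F : Submodule ℂ (K →L[ℂ] K)) :
    ∃ F' : Submodule ℂ (Ell2 →L[ℂ] Ell2), IsClosed (F' : Set (Ell2 →L[ℂ] Ell2)) ∧
      (∀ T ∈ F', IsCompactOperator T) ∧ CompletelyIsometric (subMatNorm F) (subMatNorm F') := by
  have : CompleteSpace K := FiniteDimensional.complete ℂ K
  obtain ⟨I⟩ := exists_isometry_ell2 K
  set J : K →L[ℂ] Ell2 := I.toContinuousLinearMap with hJ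
  have hJn : ‖J‖ ≤ 1 := I.norm_toContinuousLinearMap_le
  have hJJ : J.adjoint ∘L J = ContinuousLinearMap.id ℂ K := by
    ext1 ξ
    refine ext_inner_left ℂ fun η => ?_
    rw [ContinuousLinearMap.comp_apply, ContinuousLinearMap.adjoint_inner_right]
    exact I.inner_map_map η ξ
  have hJa : ‖J.adjoint‖ ≤ 1 := by rwa [LinearIsometryEquiv.norm_map]
  let A : (K →L[ℂ] K) →ₗ[ℂ] (Ell2 →L[ℂ] Ell2) :=
    { toFun := fun T => J ∘L T ∘L J.adjoint
      map_add' := fun S T => by ext1; simp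
      map_smul' := fun c T => by ext1; simp }
  have hA : ∀ T, compress J (A T) = T := by
    intro T
    ext1 ξ
    have h1 : ∀ ζ, J.adjoint (J ζ) = ζ := fun ζ => congrArg (fun S : K →L[ℂ] K => S ζ) hJJ
    simp [A, h1]
  have hinj : Function.Injective A := Function.LeftInverse.injective hA
  refine ⟨F.map A, ?_, ?_, Submodule.equivMapOfInjective A hinj F, fun k x => ?_⟩
  · exact Submodule.closed_of_finiteDimensional _
  · rintro _ ⟨T, -, rfl⟩
    exact ((isCompactOperator_of_locallyCompactSpace_rng T).clm_comp J).comp_clm J.adjoint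
  · change opMatNorm Ell2 k ((x.map F.subtype).map A) = opMatNorm K k (x.map F.subtype)
    apply le_antisymm
    · rw [opMatNorm_le_opMatNorm_iff]
      refine (norm_amplify_conj_le J J.adjoint _).trans ?_
      calc _ ≤ 1 * ‖amplify (x.map F.subtype)‖ * 1 := by gcongr
        _ = _ := by ring
    · rw [opMatNorm_le_opMatNorm_iff]
      have h := norm_amplify_compress_le hJn ((x.map F.subtype).map A)
      have h2 : ((x.map F.subtype).map A).map (compress J) = x.map F.subtype := by
        ext1 p q
        exact hA _
      rwa [h2] at h

/-! ### Realization of supremum norms by operator spaces -/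

section realize

variable {V : Type*} [AddCommGroup V] [Module ℂ V]

lemma exists_compact_of_fintype {ι : Type*} [Fintype ι] {N : ι → ℕ}
    {φ : ∀ i, V →ₗ[ℂ] (EuclideanSpace ℂ (Fin (N i)) →L[ℂ] EuclideanSpace ℂ (Fin (N i)))}
    (hφ : IsBddSep φ) :
    ∃ F : Submodule ℂ (Ell2 →L[ℂ] Ell2), IsClosed (F : Set (Ell2 →L[ℂ] Ell2)) ∧
      (∀ T ∈ F, IsCompactOperator T) ∧ CompletelyIsometric (supNorm φ) (subMatNorm F) := by
  have : FiniteDimensional ℂ (lp (fun i => EuclideanSpace ℂ (Fin (N i))) 2) :=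
    (lpPiLpₗᵢ (p := 2) (fun i => EuclideanSpace ℂ (Fin (N i)))
      ℂ).symm.toLinearEquiv.finiteDimensional
  obtain ⟨F, hF, hFK, h⟩ := exists_compact_of_finiteDimensional (LinearMap.range (blockDiag hφ))
  exact ⟨F, hF, hFK, (completelyIsometric_blockDiag hφ).trans h⟩

lemma exists_finOperatorSpace [FiniteDimensional ℂ V] {ι : Type u} {N : ι → ℕ}
    {φ : ∀ i, V →ₗ[ℂ] (EuclideanSpace ℂ (Fin (N i)) →L[ℂ] EuclideanSpace ℂ (Fin (N i)))}
    (hφ : IsBddSep φ) {n : ℕ} (hn : Module.finrank ℂ V = n) : ∃ X : FinOperatorSpace.{u} n,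
      CompletelyIsometric (supNorm φ) X.matNorm :=
  ⟨{ H := lp (fun i => EuclideanSpace ℂ (Fin (N i))) 2
     space := LinearMap.range (blockDiag hφ)
     isClosed := Submodule.closed_of_finiteDimensional _
     finiteDimensional := inferInstance
     finrank_eq := (LinearMap.finrank_range_of_inj (blockDiag_injective hφ)).trans hn },
    completelyIsometric_blockDiag hφ⟩

end realize

/-! ### Continuity in terms of distances -/

lemma continuous_logDist : Continuous logDist :=
  EReal.continuous_toENNReal.comp ENNReal.continuous_log

lemma logDist_pos {d : ℝ≥0∞} (h : 1 < d) : 0 < logDist d := by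
  rw [logDist, EReal.toENNReal_pos_iff, ← ENNReal.log_one]
  exact ENNReal.log_strictMono h

variable {n : ℕ}

instance (E : FinOperatorSpace.{u} n) : FiniteDimensional ℂ E.space := E.finiteDimensional

lemma FinOperatorSpace.isOpNorm (E : FinOperatorSpace.{u} n) : IsOpNorm E.matNorm :=
  isOpNorm_subMatNorm E.space

lemma nhds_weakTopology_le (x : OS.{u} n) {k : ℕ} (hk : 1 ≤ k) :
    @nhds _ (OS.weakTopology n) x ≤
      @nhds _ (OS.levelMetric n k).toUniformSpace.toTopologicalSpace x :=
  nhds_mono (iInf₂_le k hk)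

lemma continuousAt_of_dCb_le (E : FinOperatorSpace.{u} n)
    (h : ∀ c : ℝ≥0, 1 < c → ∃ k, 1 ≤ k ∧ ∀ X : FinOperatorSpace.{u} n,
      dCb X.matNorm E.matNorm ≤ (c : ℝ≥0∞) * dLevel X.matNorm E.matNorm k) :
    @ContinuousAt (OS.{u} n) (OS.{u} n) (OS.weakTopology n) (OS.cbTopology n) id (OS.mk E) := by
  unfold ContinuousAt
  rw [(@Metric.nhds_basis_eball _ (OS.cbMetric n) _).tendsto_right_iff]
  intro ε hε
  have hlog : Filter.Tendsto (fun c : ℝ≥0 => logDist c) (𝓝 1) (𝓝 0) := by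
    have h1 : logDist ((1 : ℝ≥0) : ℝ≥0∞) = 0 := logDist_of_le_one (by simp)
    rw [← h1]
    exact (continuous_logDist.comp ENNReal.continuous_coe).tendsto 1
  have hε2 : 0 < ε / 2 := ENNReal.half_pos hε.ne'
  have hev : ∀ᶠ c : ℝ≥0 in 𝓝[>] 1, logDist c < ε / 2 ∧ 1 < c :=
    ((hlog.mono_left nhdsWithin_le_nhds).eventually (gt_mem_nhds hε2)).and self_mem_nhdsWithin
  obtain ⟨c, hcε, hc⟩ := hev.exists
  obtain ⟨k, hk, hX⟩ := h c hc
  have hball := nhds_weakTopology_le (OS.mk E) hk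
    (@Metric.eball_mem_nhds _ (OS.levelMetric n k) (OS.mk E) _ hε2)
  filter_upwards [hball]
  rintro ⟨X⟩ hXE
  change logDist (dLevel X.matNorm E.matNorm k) < ε / 2 at hXE
  change logDist (dCb X.matNorm E.matNorm) < ε
  calc logDist (dCb X.matNorm E.matNorm)
      ≤ logDist c + logDist (dLevel X.matNorm E.matNorm k) :=
        (logDist_mono (hX X)).trans (logDist_mul_le _ _)
    _ < ε / 2 + ε / 2 := ENNReal.add_lt_add hcε hXE
    _ = ε := ENNReal.add_halves ε

/-- Otherwise there are spaces `X j` with `d_{j+1}(X j, E)` tending to one but `d_cb(X j, E) ≥ c`.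
Since `d_k` increases with `k`, they converge weakly to `E`, against continuity. -/
lemma exists_level_of_continuousAt (E : FinOperatorSpace.{u} n)
    (h : @ContinuousAt (OS.{u} n) (OS.{u} n) (OS.weakTopology n) (OS.cbTopology n) id (OS.mk E))
    {c : ℝ≥0∞} (hc : 1 < c) :
    ∃ k, 1 ≤ k ∧ ∃ c' : ℝ≥0, 1 < c' ∧ ∀ X : FinOperatorSpace.{u} n,
      dLevel X.matNorm E.matNorm k ≤ c' → dCb X.matNorm E.matNorm < c := by
  by_contra! hcon
  have hseq : ∀ j : ℕ, (1 : ℝ≥0) < 1 + (j + 1 : ℝ≥0)⁻¹ := fun j =>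
    lt_add_of_pos_right _ (by positivity)
  choose X hX1 hX2 using fun j : ℕ => hcon (j + 1) (by lia) _ (hseq j)
  have hlim : Filter.Tendsto (fun j : ℕ => logDist ((1 + (j + 1 : ℝ≥0)⁻¹ : ℝ≥0) : ℝ≥0∞))
      Filter.atTop (𝓝 0) := by
    have h1 : logDist ((1 + 0 : ℝ≥0) : ℝ≥0∞) = 0 := logDist_of_le_one (by simp)
    rw [← h1]
    refine ((continuous_logDist.comp ENNReal.continuous_coe).tendsto (1 + 0)).comp ?_
    refine Filter.Tendsto.const_add 1 ?_
    simpa using tendsto_one_div_add_atTop_nhds_zero_nat (𝕜 := ℝ≥0)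
  have hweak : Filter.Tendsto (fun j => OS.mk (X j)) Filter.atTop
      (@nhds _ (OS.weakTopology n) (OS.mk E)) := by
    rw [nhds_iInf, Filter.tendsto_iInf]
    intro k
    rw [nhds_iInf, Filter.tendsto_iInf]
    intro hk
    rw [@tendsto_iff_edist_tendsto_0 _ _ (OS.levelMetric n k)]
    refine tendsto_of_tendsto_of_tendsto_of_le_of_le' tendsto_const_nhds hlim
      (Filter.Eventually.of_forall fun _ => zero_le) ?_
    filter_upwards [Filter.eventually_ge_atTop k] with j hj
    exact logDist_mono ((dLevel_mono (X j).isOpNorm E.isOpNorm (by lia)).trans (hX1 j))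
  unfold ContinuousAt at h
  have hcb := Filter.Tendsto.comp h hweak
  rw [@tendsto_iff_edist_tendsto_0 _ _ (OS.cbMetric n)] at hcb
  obtain ⟨j, hj⟩ := (hcb.eventually (gt_mem_nhds (logDist_pos hc))).exists
  exact absurd hj (not_lt.2 (logDist_mono (hX2 j)))

/-! ### The two implications -/

lemma FinOperatorSpace.matNorm_eq_polarNorm (E : FinOperatorSpace.{u} n) :
    E.matNorm = polarNorm (dualPair E.space).flip (polarNorm (dualPair E.space) E.matNorm) := by
  funext k x
  exact (polarNorm_polarNorm_subMatNorm E.space x).symm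

lemma FinOperatorSpace.isOpNorm_polar (E : FinOperatorSpace.{u} n) :
    IsOpNorm (polarNorm (dualPair E.space) E.matNorm) :=
  isOpNorm_polarNorm _ separatingRight_dualPair E.isOpNorm

lemma FinOperatorSpace.isLawful_dual (E : FinOperatorSpace.{u} n) : IsLawful E.dual :=
  (E.isOpNorm_polar.of_completelyIsometric (completelyIsometric_dualMatNorm E.space)).lawful

/-- If `E` and its dual embed almost completely isometrically into the compact operators, then the
distance `d_cb` to `E` is almost dominated by the distance `d_k` for some `k`. -/
lemma exists_dCb_le_dLevel (E : FinOperatorSpace.{u} n) (h : dSK E.matNorm ≤ 1)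
    (h' : dSK (polarNorm (dualPair E.space) E.matNorm) ≤ 1) {c : ℝ≥0} (hc : 1 < c) :
    ∃ k, 1 ≤ k ∧ ∀ X : FinOperatorSpace.{u} n,
      dCb X.matNorm E.matNorm ≤ (c * c * (c * c) : ℝ≥0) * dLevel X.matNorm E.matNorm k := by
  obtain ⟨N, hN⟩ := exists_cbNorm_le_levelNorm.{u} E.isOpNorm h hc
  obtain ⟨N', hN'⟩ := exists_cbNorm_le_levelNorm.{u} E.isOpNorm_polar h' hc
  -- A common level for both maps; the extra one makes it positive.
  refine ⟨N + N' + 1, by lia, fun X => ?_⟩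
  have hc0 : ((c * c * (c * c) : ℝ≥0) : ℝ≥0∞) ≠ 0 := by
    have : c ≠ 0 := (zero_lt_one.trans hc).ne'
    simp [this]
  rw [dLevel, ENNReal.mul_iInf_of_ne hc0 ENNReal.coe_ne_top]
  refine le_iInf fun u => iInf_le_of_le u ?_
  have h1 : cbNorm X.matNorm E.matNorm u.toLinearMap ≤
      c * c * levelNorm X.matNorm E.matNorm (N + N' + 1) u.toLinearMap :=
    (hN _ X.isOpNorm _).trans
      (mul_le_mul' le_rfl (levelNorm_mono X.isOpNorm E.isOpNorm _ (by lia)))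
  have hadj : ∀ (v : E.space) (φ : Module.Dual ℂ X.space),
      dualPair E.space v (u.symm.toLinearMap.dualMap φ) =
        dualPair X.space (u.symm.toLinearMap v) φ := fun _ _ => rfl
  -- The inverse maps out of `E`, so its adjoint, which maps into `E*`, is estimated instead; the
  -- bidual identity returns to `u⁻¹`.
  have h2 : cbNorm E.matNorm X.matNorm u.symm.toLinearMap ≤
      c * c * levelNorm E.matNorm X.matNorm (N + N' + 1) u.symm.toLinearMap := by
    have h3 := cbNorm_adjoint_le (B := (dualPair X.space).flip) (B' := (dualPair E.space).flip)
      (u := u.symm.toLinearMap.dualMap) (u' := u.symm.toLinearMap) (fun φ v => (hadj v φ).symm)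
      X.isOpNorm_polar E.isOpNorm_polar
    rw [← X.matNorm_eq_polarNorm, ← E.matNorm_eq_polarNorm] at h3
    refine h3.trans ((hN' _ X.isOpNorm_polar _).trans (mul_le_mul' le_rfl ?_))
    exact (levelNorm_mono X.isOpNorm_polar E.isOpNorm_polar _ (by lia)).trans
      (levelNorm_adjoint_le hadj E.isOpNorm X.isOpNorm _)
  refine (mul_le_mul' h1 h2).trans_eq ?_
  push_cast
  ring

/-! ### Necessity: from continuity to embeddings into the compact operators -/

lemma dLevel_le_of_le {V : Type*} [AddCommGroup V] [Module ℂ V] {μ ν : MatNorm V} {k : ℕ}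
    {c : ℝ≥0∞} (h : levelNorm μ ν k LinearMap.id ≤ c) (h' : levelNorm ν μ k LinearMap.id ≤ 1) :
    dLevel μ ν k ≤ c :=
  iInf_le_of_le (LinearEquiv.refl ℂ V) ((mul_le_mul' h h').trans_eq (mul_one c))

lemma levelNorm_id_le {V : Type*} [AddCommGroup V] [Module ℂ V] {μ ν : MatNorm V} {k : ℕ}
    {c : ℝ≥0∞} (h : ∀ x, ν k x ≤ c * μ k x) : levelNorm μ ν k LinearMap.id ≤ c :=
  iSup₂_le fun x hx => (h x).trans (mul_le_of_le_one_right' hx)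

lemma dCb_lt_of_realization {E : FinOperatorSpace.{u} n} {k : ℕ} {c c' : ℝ≥0∞}
    (h : ∀ X : FinOperatorSpace.{u} n,
      dLevel X.matNorm E.matNorm k ≤ c' → dCb X.matNorm E.matNorm < c)
    {ρ : MatNorm E.space} (hρ : ∃ X : FinOperatorSpace.{u} n, CompletelyIsometric ρ X.matNorm)
    (hd : dLevel ρ E.matNorm k ≤ c') : dCb ρ E.matNorm < c := by
  obtain ⟨X, hX⟩ := hρ
  have hE := E.isOpNorm.lawful
  have hX' := X.isOpNorm.lawful
  have hρ := (X.isOpNorm.of_completelyIsometric hX).lawful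
  have h1 := h X (by
    rw [dLevel_comm] at hd ⊢
    exact (dLevel_le_of_completelyIsometric hE hρ hX' hX k).trans hd)
  rw [dCb_comm] at h1 ⊢
  exact (dCb_le_of_completelyIsometric hE hX' hρ hX.symm).trans_lt h1

lemma dSK_lt_of_dCb_lt {V W : Type*} [AddCommGroup V] [Module ℂ V] [AddCommGroup W] [Module ℂ W]
    {μ : MatNorm V} {ρ : MatNorm W} (hμ : IsLawful μ) (hρ : IsLawful ρ)
    (h : ∃ F : Submodule ℂ (Ell2 →L[ℂ] Ell2), IsClosed (F : Set (Ell2 →L[ℂ] Ell2)) ∧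
      (∀ T ∈ F, IsCompactOperator T) ∧ CompletelyIsometric ρ (subMatNorm F))
    {c : ℝ≥0∞} (hd : dCb μ ρ < c) : dSK μ < c := by
  obtain ⟨F, hF, hFK, hFρ⟩ := h
  exact (iInf_le_of_le F (iInf₂_le_of_le hF hFK le_rfl)).trans_lt
    ((dCb_le_of_completelyIsometric hμ hρ (isLawful_subMatNorm F) hFρ).trans_lt hd)

/-- By the bidual identity the norms of `E` are suprema over matrices in the unit ball of `E*`.
Finitely many of these give a space of matrices that is `c'`-close to `E` at level `k`, hence
`c`-close in `d_cb`. -/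
lemma dSK_matNorm_le_one (E : FinOperatorSpace.{u} n)
    (h : ∀ c : ℝ≥0∞, 1 < c → ∃ k, 1 ≤ k ∧ ∃ c' : ℝ≥0, 1 < c' ∧ ∀ X : FinOperatorSpace.{u} n,
      dLevel X.matNorm E.matNorm k ≤ c' → dCb X.matNorm E.matNorm < c) :
    dSK E.matNorm ≤ 1 := by
  refine le_of_forall_gt_imp_ge_of_dense fun c hc => ?_
  obtain ⟨k, hk, c', hc', hX⟩ := h c hc
  set B := dualPair E.space
  set ν := polarNorm B E.matNorm
  have hbs := isBddSep_evalMap B.flip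
    (LinearMap.flip_separatingRight.2 separatingLeft_dualPair) E.isOpNorm_polar
  obtain ⟨T, hT, hle⟩ := hbs.exists_finset hk hc'
  have hμ : E.matNorm = polarNorm B.flip ν := E.matNorm_eq_polarNorm
  have h1 : ∀ x, E.matNorm k x ≤ c' * supNorm (fun i : T => evalMap B.flip i.1.2.1) k x :=
    fun x => (congrFun (congrFun hμ k) x).trans_le (hle x)
  have h2 : ∀ x, supNorm (fun i : T => evalMap B.flip i.1.2.1) k x ≤ E.matNorm k x :=
    fun x => (supNorm_restrict_le (φ := fun i : MatBall ν => evalMap B.flip i.2.1) T k x).trans_eq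
      (congrFun (congrFun hμ k) x).symm
  have hlt := dCb_lt_of_realization hX
    (exists_finOperatorSpace (N := fun i : T => i.1.1) hT E.finrank_eq)
    (dLevel_le_of_le (levelNorm_id_le h1) (levelNorm_id_le fun x => by
      rw [one_mul]; exact h2 x))
  rw [dCb_comm] at hlt
  exact (dSK_lt_of_dCb_lt E.isOpNorm.lawful hT.isOpNorm.lawful
    (exists_compact_of_fintype (N := fun i : T => i.1.1) hT) hlt).le

/-- Each matrix in `T` lies, by construction, in the unit ball of the polar of the supremum over
`T`, so the bipolar recovers that supremum. -/
lemma polarNorm_polarNorm_restrict {V W : Type*} [AddCommGroup V] [Module ℂ V] [AddCommGroup W]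
    [Module ℂ W] (B : V →ₗ[ℂ] W →ₗ[ℂ] ℂ) {μ : MatNorm V} (T : Finset (MatBall μ))
    (hT : IsLawful (supNorm fun i : T => evalMap B i.1.2.1)) :
    polarNorm B (polarNorm B.flip (supNorm fun i : T => evalMap B i.1.2.1)) =
      supNorm fun i : T => evalMap B i.1.2.1 := by
  funext k y
  refine le_antisymm (polarNorm_polarNorm_le B.flip hT y) (iSup_le fun i => ?_)
  refine pairNorm_le_polarNorm B (polarNorm_le _ fun m z hz => ?_) y
  rw [pairNorm_flip]
  exact le_trans (le_iSup (fun i : T => pairNorm B i.1.2.1 z) i) hz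

/-- The finite approximation `νT` is made on `E*`, but the hypothesis concerns neighbours of `E`.
Its polar is such a neighbour, because adjoints preserve level-`k` estimates; dualizing the
resulting `d_cb` bound yields `νT` again. -/
lemma dSK_polarNorm_le_one (E : FinOperatorSpace.{u} n)
    (h : ∀ c : ℝ≥0∞, 1 < c → ∃ k, 1 ≤ k ∧ ∃ c' : ℝ≥0, 1 < c' ∧ ∀ X : FinOperatorSpace.{u} n,
      dLevel X.matNorm E.matNorm k ≤ c' → dCb X.matNorm E.matNorm < c) :
    dSK (polarNorm (dualPair E.space) E.matNorm) ≤ 1 := by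
  refine le_of_forall_gt_imp_ge_of_dense fun c hc => ?_
  obtain ⟨k, hk, c', hc', hX⟩ := h c hc
  set B := dualPair E.space
  set ν := polarNorm B E.matNorm
  have hν : IsOpNorm ν := E.isOpNorm_polar
  have hB : B.flip.SeparatingRight := LinearMap.flip_separatingRight.2 separatingLeft_dualPair
  have hbs := isBddSep_evalMap B separatingRight_dualPair E.isOpNorm
  obtain ⟨T, hT, hle⟩ := hbs.exists_finset hk hc'
  have hge : ∀ x, _ ≤ ν k x := fun x => supNorm_restrict_le
    (φ := fun i : MatBall E.matNorm => evalMap B i.2.1) T k x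
  change ∀ x, ν k x ≤ _ at hle
  have hbidual := polarNorm_polarNorm_restrict B T hT.isOpNorm.lawful
  have hνT := hT.isOpNorm
  set νT : MatNorm (Module.Dual ℂ E.space) := supNorm fun i : T => evalMap B i.1.2.1
  have hτ : IsOpNorm (polarNorm B.flip νT) := isOpNorm_polarNorm _ hB hνT
  have hid : ∀ (φ : Module.Dual ℂ E.space) (v : E.space),
      B.flip φ ((LinearMap.id : E.space →ₗ[ℂ] E.space) v) =
        B.flip ((LinearMap.id : Module.Dual ℂ E.space →ₗ[ℂ] Module.Dual ℂ E.space) φ) v :=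
    fun _ _ => rfl
  have h1 : levelNorm (polarNorm B.flip νT) E.matNorm k LinearMap.id ≤ 1 := by
    conv_lhs => rw [E.matNorm_eq_polarNorm]
    exact (levelNorm_adjoint_le hid hν hνT k).trans
      (levelNorm_id_le fun x => by rw [one_mul]; exact hge x)
  have h2 : levelNorm E.matNorm (polarNorm B.flip νT) k LinearMap.id ≤ c' := by
    conv_lhs => rw [E.matNorm_eq_polarNorm]
    exact (levelNorm_adjoint_le hid hνT hν k).trans (levelNorm_id_le hle)
  -- The predual is realized with the whole unit ball of `νT` as index set; only its dual has to be
  -- a space of finite matrices.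
  have hlt := dCb_lt_of_realization hX
    (exists_finOperatorSpace (N := fun i : MatBall νT => i.1) (isBddSep_evalMap B.flip hB hνT)
      E.finrank_eq)
    (by rw [dLevel_comm]; exact dLevel_le_of_le h2 h1)
  have hlt' := (dCb_polarNorm_le hτ E.isOpNorm).trans_lt hlt
  rw [hbidual, dCb_comm] at hlt'
  exact (dSK_lt_of_dCb_lt hν.lawful hνT.lawful
    (exists_compact_of_fintype (N := fun i : T => i.1.1) hT) hlt').le

end OpSpace

end

theorem corollary17 (n : ℕ) (hn : 1 ≤ n) (E : OpSpace.FinOperatorSpace.{u} n) :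
    @ContinuousAt (OpSpace.OS.{u} n) (OpSpace.OS.{u} n)
        (OpSpace.OS.weakTopology n) (OpSpace.OS.cbTopology n) id (OpSpace.OS.mk E) ↔
      OpSpace.dSK E.matNorm = 1 ∧ OpSpace.dSK E.dual = 1 := by
  have : Nontrivial E.space := Module.nontrivial_of_finrank_pos (R := ℂ) (by
    rw [E.finrank_eq]; exact hn)
  have hci := OpSpace.completelyIsometric_dualMatNorm E.space
  constructor
  · intro h
    have h' := fun c hc => OpSpace.exists_level_of_continuousAt E h (c := c) hc
    refine ⟨le_antisymm (OpSpace.dSK_matNorm_le_one E h')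
      (OpSpace.one_le_dSK E.isOpNorm.lawful), le_antisymm ?_ ?_⟩
    · exact (OpSpace.dSK_le_of_completelyIsometric E.isOpNorm_polar.lawful E.isLawful_dual
        hci.symm).trans (OpSpace.dSK_polarNorm_le_one E h')
    · exact (OpSpace.one_le_dSK E.isOpNorm_polar.lawful).trans
        (OpSpace.dSK_le_of_completelyIsometric E.isLawful_dual E.isOpNorm_polar.lawful hci)
  · rintro ⟨h, h'⟩
    refine OpSpace.continuousAt_of_dCb_le E fun c hc => ?_
    -- The comparison of `d_cb` with `d_k` costs the fourth power of its constant, hence the fourth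
    -- root.
    have hc' : 1 < NNReal.sqrt (NNReal.sqrt c) := by
      rw [← NNReal.sqrt_one, NNReal.sqrt_lt_sqrt, ← NNReal.sqrt_one, NNReal.sqrt_lt_sqrt]
      exact hc
    obtain ⟨k, hk, hX⟩ := OpSpace.exists_dCb_le_dLevel E h.le
      ((OpSpace.dSK_le_of_completelyIsometric E.isLawful_dual E.isOpNorm_polar.lawful hci).trans
        h'.le) hc'
    exact ⟨k, hk, by simpa using hX⟩
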